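/- **Setting.** For $\gamma\in[0,\infty)$ let $\phi(\gamma)=E\big[(X-E[X\mid Y])^2\big]$, where $X$ is equiprobable on $\{+1,-1\}$, $Y=\sqrt{\gamma}\,X+N$, and $N\sim\mathcal N(0,1)$ is independent of $X$; put $\phi(\infty)=0$. Let $L_\gamma=2\sqrt{\gamma}\,Y$ be the log likelihood ratio of $X$ given $Y$ (so $L_\gamma\sim\mathcal N(2\gamma x,4\gamma)$ given $X=x$), and let $L_\infty=X\cdot\infty$. For a nonempty binary code $\mathbf C\subseteq\{+1,-1\}^n$, $n\ge 1$, of rate $\frac1n\log_2|\mathbf C|$, let $\vec X$ be uniform on $\mathbf C$ and let the a priori information come from a Gaussian channel with signal to noise ratio $\gamma_{ap}$: $Y_j=\sqrt{\gamma_{ap}}\,X_j+N_j$, with $N_1,\dots,N_n$ i.i.d. $\mathcal N(0,1)$ and independent of $\vec X$. The extrinsic log likelihood ratio of the $k$-th symbol is $$L_{ext,k}=\log\frac{P\big(X_k=1\mid (Y_j)_{j\ne k}\big)}{P\big(X_k=-1\mid (Y_j)_{j\ne k}\big)}\in[-\infty,\infty].$$ Let $(\mathbf C_m)$ be a sequence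 of such codes whose rates converge to $R$ (for a single code of rate $R$, take a constant sequence). Let $D\subseteq[0,\infty)$ have a Lebesgue-null complement in $[0,\infty)$, let $\gamma_{ext}:D\to[0,\infty]$, and suppose that for every $\gamma_{ap}\in D$ the extrinsic information is that of a Gaussian channel with signal to noise ratio $\gamma_{ext}(\gamma_{ap})$: if $K$ is a uniformly random position, independent of codeword and noise, then the law of $(X_K,L_{ext,K})$ for $\mathbf C_m$ converges weakly, as $m\to\infty$, to the law of $(X,L_{\gamma_{ext}(\gamma_{ap})})$ (for a constant sequence: is equal to it). **Lemma.** View $\gamma_{ap}$ as a function of $\gamma_{ext}$ along the transfer curve, with the jumps of the curve filled in by segments on which $\gamma_{ap}$ is constant, that is, for $s\in[0,\infty)$, $$\gamma_{ap}(s)=\inf\{t\in D:\ \gamma_{ext}(t)\ge s\}\in[0,\infty],\qquad \inf\emptyset=\infty .$$ Then $s\mapsto\phi(\gamma_{ap}(s)+s)$ is integrable on $(0,\infty)$ and $$\int_0^\infty \phi(\gamma_{ap}+\gamma_{ext})\,d\gamma_{ext}=\int_0^\infty\phi\big(\gamma_{ap}(s)+s\big)\,ds=(1-R)\ln 4 .$$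 -/

import Mathlib

open MeasureTheory ProbabilityTheory Filter Topology Set
open scoped NNReal ENNReal BoundedContinuousFunction

namespace MSEChart

/-- The antipodal symbol `+1` or `-1` that carries a bit. -/
def bpsk (b : Bool) : ℝ := if b then 1 else -1

/-! ### A single equiprobable bit over an additive white Gaussian noise channel -/

/-- Joint law of an equiprobable bit and an independent standard Gaussian noise sample. -/
noncomputable def bitLaw : Measure (Bool × ℝ) :=
  (uniformOn (Set.univ : Set Bool)).prod (gaussianReal 0 1)

/-- The channel output `Y = √γ X + N`. -/
noncomputable def bitOutput (γ : ℝ≥0) (ω : Bool × ℝ) : ℝ :=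
  √(γ : ℝ) * bpsk ω.1 + ω.2

/-- The estimate `E[X | Y]`. -/
noncomputable def bitEstimate (γ : ℝ≥0) : Bool × ℝ → ℝ :=
  bitLaw[fun ω => bpsk ω.1 | MeasurableSpace.comap (bitOutput γ) inferInstance]

/-- The minimum mean squared error `φ(γ) = E[(X - E[X | Y])²]`. An infinite signal to noise ratio
stands for a noiseless channel, whose error is zero. -/
noncomputable def phi (γ : ℝ≥0∞) : ℝ :=
  if γ = ⊤ then 0
  else ∫ ω, (bpsk ω.1 - bitEstimate γ.toNNReal ω) ^ 2 ∂bitLaw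

/-- The log likelihood ratio of the bit given `Y = √γ X + N`, that is `2 √γ Y`, which has law
`𝒩(2 γ x, 4 γ)` when `X = x`. It is `±∞`, with the sign of the bit, over a noiseless channel. -/
noncomputable def gaussLLR (γ : ℝ≥0∞) (ω : Bool × ℝ) : EReal :=
  if γ = ⊤ then (if ω.1 then ⊤ else ⊥)
  else ((2 * √(γ.toNNReal : ℝ) * bitOutput γ.toNNReal ω : ℝ) : EReal)

/-! ### A binary code -/

variable {n : ℕ}

/-- The rate of a code of length `n`, in bits per symbol. -/
noncomputable def rate (C : Finset (Fin n → Bool)) : ℝ := Real.logb 2 (C.card : ℝ) / n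

/-- Joint law of a uniformly distributed codeword and of independent standard Gaussian noise. -/
noncomputable def codeLaw (C : Finset (Fin n → Bool)) :
    Measure ((Fin n → Bool) × (Fin n → ℝ)) :=
  (uniformOn (C : Set (Fin n → Bool))).prod (Measure.pi fun _ => gaussianReal 0 1)

/-- The a priori observations of all the symbols but the `k`-th: `Y_j = √γ X_j + N_j`, `j ≠ k`. -/
noncomputable def othersOutput (γ : ℝ≥0) (k : Fin n) (ω : (Fin n → Bool) × (Fin n → ℝ)) :
    {j : Fin n // j ≠ k} → ℝ :=
  fun j => √(γ : ℝ) * bpsk (ω.1 j) + ω.2 j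

/-- The conditional probability that the `k`-th bit of the codeword is `b`, given the a priori
observations of all the other symbols. -/
noncomputable def extProb (C : Finset (Fin n → Bool)) (γ : ℝ≥0) (k : Fin n) (b : Bool) :
    (Fin n → Bool) × (Fin n → ℝ) → ℝ :=
  (codeLaw C)[Set.indicator {ω | ω.1 k = b} (fun _ => (1 : ℝ)) |
    MeasurableSpace.comap (othersOutput γ k) inferInstance]

/-- The extrinsic log likelihood ratio of the `k`-th bit; it is infinite when the bit is
determined by the other observations. -/
noncomputable def extLLR (C : Finset (Fin n → Bool)) (γ : ℝ≥0) (k : Fin n)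
    (ω : (Fin n → Bool) × (Fin n → ℝ)) : EReal :=
  ENNReal.log (ENNReal.ofReal (extProb C γ k true ω)) -
    ENNReal.log (ENNReal.ofReal (extProb C γ k false ω))

/-- Expectation of a function of a bit and of its extrinsic log likelihood ratio, averaged over
the `n` positions of the code. -/
noncomputable def extMean (C : Finset (Fin n → Bool)) (γ : ℝ≥0) (f : Bool × EReal → ℝ) : ℝ :=
  (∑ k : Fin n, ∫ ω, f (ω.1 k, extLLR C γ k ω) ∂codeLaw C) / n

/-! ### The Gaussian model and the transfer curve -/

/-- When the a priori information comes from a Gaussian channel of signal to noise ratio `γap`,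
the extrinsic information about the code symbols is that of a Gaussian channel of signal to noise
ratio `γext`: the law of (bit, extrinsic log likelihood ratio), over the positions of the code,
converges weakly, along the sequence of codes, to the law of (bit, log likelihood ratio) for an
equiprobable bit sent over that channel. For a constant sequence the two laws are equal. -/
def ExtrinsicIsGaussian {len : ℕ → ℕ} (C : ∀ m, Finset (Fin (len m) → Bool))
    (γap : ℝ≥0) (γext : ℝ≥0∞) : Prop :=
  ∀ f : (Bool × EReal) →ᵇ ℝ,
    Tendsto (fun m => extMean (C m) γap f) atTop
      (𝓝 (∫ ω, f (ω.1, gaussLLR γext ω) ∂bitLaw))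

/-- The a priori signal to noise ratio as a function of the extrinsic one, along the transfer curve
`γap ↦ γext γap`, `γap ∈ D`, whose jumps are filled in by segments on which `γap` is constant. It is
`∞` at the values that lie above the whole curve. -/
noncomputable def apOfExt (D : Set ℝ≥0) (γext : ℝ≥0 → ℝ≥0∞) (s : ℝ≥0∞) : ℝ≥0∞ :=
  ⨅ t ∈ {t : ℝ≥0 | t ∈ D ∧ s ≤ γext t}, (t : ℝ≥0∞)

end MSEChart

/-! The engine is the I-MMSE relation. For distinct equiprobable signals in standard Gaussian noise,
the conditional entropy of the message (in nats) has derivative minus half the total minimum mean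
squared error with respect to the signal to noise ratio. It falls from the full entropy to `0`, so
the error integrates to twice the entropy (`integral_sum_mse_post`). A single bit gives `∫ φ = ln
4`; a code gives, per symbol, its rate times `ln 4`.

Given all the observations, a symbol is estimated by adding its extrinsic log likelihood ratio to
that of its own, independent observation (`llrMeanShift_bitPost`). Independent Gaussian channels
combine by adding their signal to noise ratios, so under the hypothesis the error per symbol tends
to `φ(t + γext t)` for almost every `t` (`integral_llrErrorWith_gaussLLR`, `extMean_llrErrorWith`).
It is dominated by `φ(t)`, the error of the own observation alone, whence `∫ φ(t + γext t) dt = R ln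
4`.

Given only the other observations, the error per symbol is nonincreasing in `t` and tends to `φ(γext
t)`; as `φ` is strictly decreasing, `γext` is monotone on `D`. The filled-in curve therefore crosses
each antidiagonal `t + s = v` at one point `(τ, v - τ)`, and the part of the curve before the
crossing has projections of lengths `τ` and `v - τ`, which add up to `v`. Superlevel sets of `φ` are
initial intervals, so the layer cake formula yields `∫ φ(t + γext t) dt + ∫ φ(γap(s) + s) ds = ∫ φ =
ln 4` (`volume_curve_add`, `lintegral_curve_add`). Subtraction finishes the proof. -/

namespace MSEChart

/-! ### Gaussian noise: change of measure, integration by parts, rotations -/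

/-- It suffices to test boxes, on which the restricted density factors over independent coordinates.
-/
theorem pi_withDensity {ι : Type*} [Fintype ι] {E : ι → Type*} [∀ i, MeasurableSpace (E i)]
    (μ : ∀ i, Measure (E i)) [∀ i, IsProbabilityMeasure (μ i)] (f : ∀ i, E i → ℝ≥0∞)
    (hf : ∀ i, Measurable (f i)) [∀ i, IsProbabilityMeasure ((μ i).withDensity (f i))] :
    (Measure.pi μ).withDensity (fun y => ∏ i, f i (y i)) =
      Measure.pi fun i => (μ i).withDensity (f i) := by
  symm
  refine Measure.pi_eq fun s hs => ?_
  rw [withDensity_apply _ (MeasurableSet.univ_pi hs), ← lintegral_indicator (MeasurableSet.univ_pi hs)]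
  have h1 : ∀ y : ∀ i, E i, (univ.pi s).indicator (fun y => ∏ i, f i (y i)) y
      = ∏ i, (s i).indicator (f i) (y i) := by
    intro y
    by_cases hy : y ∈ univ.pi s
    · rw [indicator_of_mem hy]
      exact Finset.prod_congr rfl fun i _ => (indicator_of_mem (hy i (mem_univ i)) _).symm
    · rw [indicator_of_notMem hy]
      have : ∃ i, y i ∉ s i := by simpa [Set.mem_pi] using hy
      obtain ⟨i, hi⟩ := this
      exact (Finset.prod_eq_zero (Finset.mem_univ i) (indicator_of_notMem hi _)).symm
  simp_rw [h1]
  have hm : ∀ i, Measurable ((s i).indicator (f i)) := fun i => (hf i).indicator (hs i)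
  rw [lintegral_prod_eq_prod_lintegral_of_indepFun Finset.univ
    (fun i (y : ∀ i, E i) => (s i).indicator (f i) (y i))
    (iIndepFun_pi (X := fun i => (s i).indicator (f i)) fun i => (hm i).aemeasurable)
    (fun i => (hm i).comp (measurable_pi_apply i))]
  refine Finset.prod_congr rfl fun i _ => ?_
  rw [withDensity_apply _ (hs i), ← lintegral_indicator (hs i),
    ← (measurePreserving_eval μ i).lintegral_comp (hm i)]

/-- The standard Gaussian measure on `ι → ℝ`. -/
noncomputable def stdNoise (ι : Type*) [Fintype ι] : Measure (ι → ℝ) :=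
  Measure.pi fun _ => gaussianReal 0 1

instance {ι : Type*} [Fintype ι] : IsProbabilityMeasure (stdNoise ι) := by
  unfold stdNoise; infer_instance

/-- Density of the law of `a s + n` with respect to the law of the standard Gaussian noise `n`. -/
noncomputable def lik {ι : Type*} [Fintype ι] (a : ℝ) (s y : ι → ℝ) : ℝ :=
  Real.exp (∑ j, (a * s j * y j - (a * s j) ^ 2 / 2))

theorem gaussianReal_map_add_withDensity (m : ℝ) :
    (gaussianReal 0 1).map (fun n => m + n) =
      (gaussianReal 0 1).withDensity (fun y => ENNReal.ofReal (Real.exp (m * y - m ^ 2 / 2))) := by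
  rw [gaussianReal_map_const_add, gaussianReal_of_var_ne_zero _ one_ne_zero,
    gaussianReal_of_var_ne_zero _ one_ne_zero,
    ← withDensity_mul _ (measurable_gaussianPDF _ _) (by fun_prop)]
  congr 1
  ext y
  simp only [gaussianPDF, Pi.mul_apply]
  rw [← ENNReal.ofReal_mul (gaussianPDFReal_nonneg _ _ _)]
  congr 1
  simp only [gaussianPDFReal, mul_assoc, ← Real.exp_add]
  congr 2
  simp
  ring

variable {ι : Type*} [Fintype ι]

theorem lik_pos (a : ℝ) (s y : ι → ℝ) : 0 < lik a s y := Real.exp_pos _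

theorem continuous_lik (a : ℝ) (s : ι → ℝ) : Continuous (lik a s) := by
  unfold lik; fun_prop

theorem measurable_shift {ι : Type*} (a : ℝ) (s : ι → ℝ) :
    Measurable (fun (n : ι → ℝ) j => a * s j + n j) := by
  fun_prop

/-- The finite-dimensional Cameron–Martin formula. It puts the observations under all messages on
one reference measure, so that posteriors become ratios of sums of `lik`. -/
theorem stdNoise_map_shift (a : ℝ) (s : ι → ℝ) :
    (stdNoise ι).map (fun n j => a * s j + n j) =
      (stdNoise ι).withDensity (fun y => ENNReal.ofReal (lik a s y)) := by
  have hp : ∀ j, IsProbabilityMeasure ((gaussianReal 0 1).withDensity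
      (fun y => ENNReal.ofReal (Real.exp (a * s j * y - (a * s j) ^ 2 / 2)))) := fun j => by
    rw [← gaussianReal_map_add_withDensity]
    exact Measure.isProbabilityMeasure_map (by fun_prop)
  have h := Measure.pi_map_pi (μ := fun _ : ι => gaussianReal 0 1)
    (f := fun j n => a * s j + n) (hμ := fun j => by
      have := Measure.isProbabilityMeasure_map (μ := gaussianReal 0 1) (f := fun n => a * s j + n)
        (by fun_prop)
      infer_instance) (fun j => by fun_prop)
  rw [stdNoise, h]
  simp_rw [gaussianReal_map_add_withDensity]
  rw [← pi_withDensity _ _ (fun j => by fun_prop)]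
  congr 1
  ext y
  rw [lik, Real.exp_sum, ENNReal.ofReal_prod_of_nonneg fun j _ => (Real.exp_pos _).le]

theorem integral_shift (a : ℝ) (s : ι → ℝ) {F : (ι → ℝ) → ℝ} (hF : Measurable F) :
    ∫ n, F (fun j => a * s j + n j) ∂stdNoise ι = ∫ y, lik a s y * F y ∂stdNoise ι := by
  have h := integral_map (μ := stdNoise ι) (φ := fun n j => a * s j + n j)
    (measurable_shift a s).aemeasurable
    (hF.aestronglyMeasurable (μ := (stdNoise ι).map (fun n j => a * s j + n j)))
  rw [← h, stdNoise_map_shift, integral_withDensity_eq_integral_toReal_smul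
    (by have := (continuous_lik a s).measurable; fun_prop) (ae_of_all _ fun _ => ENNReal.ofReal_lt_top)]
  simp only [ENNReal.toReal_ofReal (lik_pos a s _).le, smul_eq_mul]

theorem integrable_lik (a : ℝ) (s : ι → ℝ) : Integrable (lik a s) (stdNoise ι) := by
  have hp : IsProbabilityMeasure ((stdNoise ι).map (fun n j => a * s j + n j)) :=
    Measure.isProbabilityMeasure_map (measurable_shift a s).aemeasurable
  rw [stdNoise_map_shift] at hp
  have h1 : ∫⁻ y, ENNReal.ofReal (lik a s y) ∂stdNoise ι = 1 := by
    have := hp.measure_univ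
    rwa [withDensity_apply _ MeasurableSet.univ, Measure.restrict_univ] at this
  refine ⟨(continuous_lik a s).aestronglyMeasurable, ?_⟩
  rw [hasFiniteIntegral_iff_ofReal (ae_of_all _ fun y => (lik_pos a s y).le), h1]
  exact ENNReal.one_lt_top

theorem integrable_lik_mul (a : ℝ) (s : ι → ℝ) {F : (ι → ℝ) → ℝ} (hF : Measurable F) {B : ℝ}
    (hB : ∀ y, |F y| ≤ B) : Integrable (fun y => lik a s y * F y) (stdNoise ι) :=
  (integrable_lik a s).mul_bdd (c := B) hF.aestronglyMeasurable (ae_of_all _ hB)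

/-- Resampling one coordinate is harmless. This serves twice: to integrate by parts in one
coordinate, and to separate the noise of a symbol from that of the other symbols. -/
theorem measurePreserving_update [DecidableEq ι] (j : ι) :
    MeasurePreserving (fun p : (ι → ℝ) × ℝ => Function.update p.1 j p.2)
      ((stdNoise ι).prod (gaussianReal 0 1)) (stdNoise ι) := by
  have hm : Measurable (fun p : (ι → ℝ) × ℝ => Function.update p.1 j p.2) := by
    refine measurable_pi_lambda _ fun i => ?_
    by_cases h : i = j
    · subst h; simpa using measurable_snd
    · simp only [Function.update_of_ne h]; fun_prop
  refine ⟨hm, ?_⟩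
  refine (Measure.pi_eq fun s hs => ?_).symm
  rw [Measure.map_apply hm (MeasurableSet.univ_pi hs)]
  have : (fun p : (ι → ℝ) × ℝ => Function.update p.1 j p.2) ⁻¹' univ.pi s
      = (univ.pi (Function.update s j univ)) ×ˢ (s j) := by
    ext p
    simp only [mem_preimage, mem_univ_pi, mem_prod]
    constructor
    · intro h
      refine ⟨fun i => ?_, by simpa using h j⟩
      by_cases hi : i = j
      · subst hi; simp
      · simpa [hi] using h i
    · rintro ⟨h, hj⟩ i
      by_cases hi : i = j
      · subst hi; simpa using hj
      · simpa [hi] using h i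
  rw [this, Measure.prod_prod, stdNoise, Measure.pi_pi, ← Finset.prod_erase_mul _ _ (Finset.mem_univ j),
    ← Finset.prod_erase_mul Finset.univ (fun i => (gaussianReal 0 1) (s i)) (Finset.mem_univ j)]
  simp only [Function.update_self, measure_univ, mul_one]
  congr 1
  refine Finset.prod_congr rfl fun i hi => ?_
  rw [Function.update_of_ne (Finset.ne_of_mem_erase hi)]

theorem integral_eq_integral_update [DecidableEq ι] (j : ι) {F : (ι → ℝ) → ℝ}
    (hF : Integrable F (stdNoise ι)) :
    ∫ n, F n ∂stdNoise ι = ∫ n, ∫ t, F (Function.update n j t) ∂gaussianReal 0 1 ∂stdNoise ι := by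
  have h := measurePreserving_update (ι := ι) j
  rw [← h.map_eq, integral_map h.measurable.aemeasurable (by rw [h.map_eq]; exact hF.1), integral_prod]
  · rw [h.map_eq]
  · exact h.integrable_comp_of_integrable hF

theorem integrable_of_bdd_measurable {E : Type*} [MeasurableSpace E] {μ : Measure E}
    [IsFiniteMeasure μ] {F : E → ℝ} (hF : Measurable F) {B : ℝ} (hB : ∀ y, |F y| ≤ B) :
    Integrable F μ :=
  Integrable.of_bound hF.aestronglyMeasurable B (ae_of_all _ hB)

/-- Stein's identity: the Gaussian density satisfies `p' = -t p`, and the boundary terms vanish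
because everything is integrable. -/
theorem integral_id_mul_gaussianReal {f f' : ℝ → ℝ} (hf : ∀ t, HasDerivAt f (f' t) t)
    (hm : Measurable f') {B B' : ℝ} (hB : ∀ t, |f t| ≤ B) (hB' : ∀ t, |f' t| ≤ B') :
    ∫ t, t * f t ∂gaussianReal 0 1 = ∫ t, f' t ∂gaussianReal 0 1 := by
  rw [integral_gaussianReal_eq_integral_smul one_ne_zero,
    integral_gaussianReal_eq_integral_smul one_ne_zero]
  set p := gaussianPDFReal 0 1
  have hp : ∀ t, HasDerivAt p (-(t * p t)) t := by
    intro t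
    have : p = fun t => (√(2 * Real.pi))⁻¹ * Real.exp (-t ^ 2 / 2) := by
      ext t; simp [p, gaussianPDFReal]
    rw [this]
    have h := (((hasDerivAt_id t).pow 2).neg.div_const 2).exp.const_mul (√(2 * Real.pi))⁻¹
    refine h.congr_deriv ?_
    simp; ring
  have hfm : Measurable f := (continuous_iff_continuousAt.2 fun t => (hf t).continuousAt).measurable
  have hpi : Integrable p := integrable_gaussianPDFReal 0 1
  have hpt : Integrable (fun t => t * p t) := by
    have h := (memLp_id_gaussianReal (μ := 0) (v := 1) 1).integrable le_rfl
    rw [gaussianReal_of_var_ne_zero _ one_ne_zero, integrable_withDensity_iff_integrable_smul'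
      (measurable_gaussianPDF _ _) (ae_of_all _ fun _ => gaussianPDF_lt_top)] at h
    refine h.congr (ae_of_all _ fun t => ?_)
    simp [p, mul_comm]
  have h := integral_mul_deriv_eq_deriv_mul_of_integrable (u := f) (v := p) (u' := f')
    (v' := fun t => -(t * p t)) (fun t _ => hf t) (fun t _ => hp t)
    (hpt.neg.bdd_mul hfm.aestronglyMeasurable (ae_of_all _ hB))
    (hpi.bdd_mul hm.aestronglyMeasurable (ae_of_all _ hB'))
    (hpi.bdd_mul hfm.aestronglyMeasurable (ae_of_all _ hB))
  simp only [smul_eq_mul]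
  calc ∫ t, p t * (t * f t) = -∫ t, f t * -(t * p t) := by
        rw [← integral_neg]; congr 1; ext t; ring
    _ = ∫ t, p t * f' t := by rw [h, neg_neg]; congr 1; ext t; ring

theorem integrable_eval_stdNoise (j : ι) : Integrable (fun n => n j) (stdNoise ι) :=
  integrable_comp_eval (μ := fun _ : ι => gaussianReal 0 1) (f := id)
    ((memLp_id_gaussianReal (μ := 0) (v := 1) 1).integrable le_rfl)

theorem integrable_eval_sq_stdNoise (j : ι) : Integrable (fun n => n j ^ 2) (stdNoise ι) :=
  integrable_comp_eval (μ := fun _ : ι => gaussianReal 0 1) (f := fun t => t ^ 2)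
    ((memLp_id_gaussianReal (μ := 0) (v := 1) 2).integrable_sq)

/-- Gaussian integration by parts in one coordinate. -/
theorem integral_eval_mul_stdNoise [DecidableEq ι] (j : ι) {f f' : (ι → ℝ) → ℝ}
    (hf : ∀ n t, HasDerivAt (fun t => f (Function.update n j t)) (f' (Function.update n j t)) t)
    (hfm : Measurable f) (hm : Measurable f') {B B' : ℝ} (hB : ∀ n, |f n| ≤ B)
    (hB' : ∀ n, |f' n| ≤ B') :
    ∫ n, n j * f n ∂stdNoise ι = ∫ n, f' n ∂stdNoise ι := by
  rw [integral_eq_integral_update j ((integrable_eval_stdNoise j).mul_bdd (c := B) hfm.aestronglyMeasurable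
      (ae_of_all _ hB)),
    integral_eq_integral_update j (integrable_of_bdd_measurable hm hB')]
  congr 1
  ext n
  simp only [Function.update_self]
  exact integral_id_mul_gaussianReal (hf n) (hm.comp (measurable_update n)) (fun t => hB _)
    (fun t => hB' _)

/-- Used in both directions: to degrade a channel by adding noise, and to merge two independent
observations into one. -/
theorem gaussianReal_prod_map_rotation {p q : ℝ} (h : p ^ 2 + q ^ 2 = 1) :
    ((gaussianReal 0 1).prod (gaussianReal 0 1)).map (fun z => p * z.1 + q * z.2) =
      gaussianReal 0 1 := by
  have h1 : ((gaussianReal 0 1).prod (gaussianReal 0 1)).map (fun z : ℝ × ℝ => p * z.1) =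
      gaussianReal 0 (.mk (p ^ 2) (sq_nonneg p)) := by
    have := Measure.map_map (μ := (gaussianReal 0 1).prod (gaussianReal 0 1))
      (g := fun t : ℝ => p * t) (f := Prod.fst) (by fun_prop) (by fun_prop)
    rw [show (fun z : ℝ × ℝ => p * z.1) = (fun t : ℝ => p * t) ∘ Prod.fst from rfl, ← this]
    rw [Measure.map_fst_prod, measure_univ, one_smul, gaussianReal_map_const_mul]
    simp
  have h2 : ((gaussianReal 0 1).prod (gaussianReal 0 1)).map (fun z : ℝ × ℝ => q * z.2) =
      gaussianReal 0 (.mk (q ^ 2) (sq_nonneg q)) := by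
    have := Measure.map_map (μ := (gaussianReal 0 1).prod (gaussianReal 0 1))
      (g := fun t : ℝ => q * t) (f := Prod.snd) (by fun_prop) (by fun_prop)
    rw [show (fun z : ℝ × ℝ => q * z.2) = (fun t : ℝ => q * t) ∘ Prod.snd from rfl, ← this]
    rw [Measure.map_snd_prod, measure_univ, one_smul, gaussianReal_map_const_mul]
    simp
  have hi : IndepFun (fun z : ℝ × ℝ => p * z.1) (fun z : ℝ × ℝ => q * z.2)
      ((gaussianReal 0 1).prod (gaussianReal 0 1)) :=
    indepFun_prod (X := fun t : ℝ => p * t) (Y := fun t : ℝ => q * t) (by fun_prop) (by fun_prop)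
  have h3 := gaussianReal_add_gaussianReal_of_indepFun hi h1 h2
  have h4 : NNReal.mk (p ^ 2) (sq_nonneg p) + (NNReal.mk (q ^ 2) (sq_nonneg q)) = 1 := by
    ext; simpa using h
  rw [h4, add_zero] at h3
  exact h3

theorem stdNoise_prod_map_rotation {p q : ℝ} (h : p ^ 2 + q ^ 2 = 1) :
    MeasurePreserving (fun z : (ι → ℝ) × (ι → ℝ) => fun j => p * z.1 j + q * z.2 j)
      ((stdNoise ι).prod (stdNoise ι)) (stdNoise ι) := by
  have h1 := measurePreserving_arrowProdEquivProdArrow ℝ ℝ ι (fun _ => gaussianReal 0 1)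
    (fun _ => gaussianReal 0 1)
  have h2 := h1.symm
  have h3 : MeasurePreserving (fun (x : ι → ℝ × ℝ) j => p * (x j).1 + q * (x j).2)
      (Measure.pi fun _ : ι => (gaussianReal 0 1).prod (gaussianReal 0 1)) (stdNoise ι) := by
    refine ⟨by fun_prop, ?_⟩
    have := Measure.pi_map_pi (μ := fun _ : ι => (gaussianReal 0 1).prod (gaussianReal 0 1))
      (f := fun _ z => p * z.1 + q * z.2) (hμ := fun j => by
        rw [gaussianReal_prod_map_rotation h]; infer_instance) (fun j => by fun_prop)
    rw [this, gaussianReal_prod_map_rotation h]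
    rfl
  exact h3.comp h2

theorem measurePreserving_restrict_ne [DecidableEq ι] (k : ι) :
    MeasurePreserving (fun (n : ι → ℝ) (j : {j // j ≠ k}) => n j) (stdNoise ι)
      (stdNoise {j // j ≠ k}) := by
  have h := measurePreserving_piEquivPiSubtypeProd (fun _ : ι => gaussianReal 0 1) (fun j => j ≠ k)
  have h2 : MeasurePreserving (Prod.fst : ({j // j ≠ k} → ℝ) × ({j // ¬ j ≠ k} → ℝ) → _)
    ((Measure.pi fun _ => gaussianReal 0 1).prod (Measure.pi fun _ => gaussianReal 0 1))
    (Measure.pi fun _ => gaussianReal 0 1) := measurePreserving_fst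
  exact h2.comp h

end MSEChart

namespace MSEChart

/-! ### Posterior means and their mean squared error -/

variable {ι : Type*} [Fintype ι] {A : Type*}

/-- Posterior mean of `f c` given `a x c + n = y`, for `c` uniform on `C` and standard Gaussian
noise `n`. -/
noncomputable def post (C : Finset A) (a : ℝ) (x : A → ι → ℝ) (f : A → ℝ) (y : ι → ℝ) : ℝ :=
  (∑ c ∈ C, f c * lik a (x c) y) / ∑ c ∈ C, lik a (x c) y

/-- Mean squared error of the estimate `h` of `f c` from `a x c + n`. -/
noncomputable def mse (C : Finset A) (a : ℝ) (x : A → ι → ℝ) (f : A → ℝ) (h : (ι → ℝ) → ℝ) : ℝ :=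
  (∑ c ∈ C, ∫ n, (f c - h fun j => a * x c j + n j) ^ 2 ∂stdNoise ι) / C.card

variable {C : Finset A} {a : ℝ} {x : A → ι → ℝ} {f : A → ℝ}

theorem sum_lik_pos (hC : C.Nonempty) (a : ℝ) (x : A → ι → ℝ) (y : ι → ℝ) :
    0 < ∑ c ∈ C, lik a (x c) y :=
  Finset.sum_pos (fun c _ => lik_pos a (x c) y) hC

theorem continuous_post (hC : C.Nonempty) : Continuous (post C a x f) := by
  unfold post
  refine Continuous.div ?_ ?_ fun y => (sum_lik_pos hC a x y).ne'
  · exact continuous_finsetSum _ fun c _ => continuous_const.mul (continuous_lik a (x c))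
  · exact continuous_finsetSum _ fun c _ => continuous_lik a (x c)

theorem post_mul_sum (hC : C.Nonempty) (y : ι → ℝ) :
    post C a x f y * ∑ c ∈ C, lik a (x c) y = ∑ c ∈ C, f c * lik a (x c) y :=
  div_mul_cancel₀ _ (sum_lik_pos hC a x y).ne'

theorem abs_post_le_of_le (hC : C.Nonempty) {B : ℝ} (hB : ∀ c ∈ C, |f c| ≤ B) (y : ι → ℝ) :
    |post C a x f y| ≤ B := by
  rw [post, abs_div, abs_of_pos (sum_lik_pos hC a x y), div_le_iff₀ (sum_lik_pos hC a x y),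
    Finset.mul_sum]
  refine (Finset.abs_sum_le_sum_abs _ _).trans (Finset.sum_le_sum fun c hc => ?_)
  rw [abs_mul, abs_of_pos (lik_pos a (x c) y)]
  exact mul_le_mul_of_nonneg_right (hB c hc) (lik_pos a (x c) y).le

theorem abs_le_sum_abs (f : A → ℝ) : ∀ c ∈ C, |f c| ≤ ∑ c ∈ C, |f c| := fun _ hc =>
  Finset.single_le_sum (f := fun c => |f c|) (fun _ _ => abs_nonneg _) hc

theorem abs_post_le (hC : C.Nonempty) (y : ι → ℝ) :
    |post C a x f y| ≤ ∑ c ∈ C, |f c| :=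
  abs_post_le_of_le hC (abs_le_sum_abs f) y

theorem post_add (f g : A → ℝ) (y : ι → ℝ) :
    post C a x (fun c => f c + g c) y = post C a x f y + post C a x g y := by
  simp only [post, add_mul, Finset.sum_add_distrib, add_div]

theorem post_const_mul (r : ℝ) (f : A → ℝ) (y : ι → ℝ) :
    post C a x (fun c => r * f c) y = r * post C a x f y := by
  simp only [post, mul_assoc, ← Finset.mul_sum, mul_div_assoc]

theorem post_sum {κ : Type*} (s : Finset κ) (f : κ → A → ℝ) (y : ι → ℝ) :
    post C a x (fun c => ∑ j ∈ s, f j c) y = ∑ j ∈ s, post C a x (f j) y := by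
  simp only [post, Finset.sum_mul]
  rw [Finset.sum_comm, Finset.sum_div]

theorem post_const (hC : C.Nonempty) (r : ℝ) (y : ι → ℝ) : post C a x (fun _ => r) y = r := by
  rw [post, ← Finset.mul_sum, mul_div_cancel_right₀ _ (sum_lik_pos hC a x y).ne']

/-- The posterior mean is the barycentre for the weights `lik`; moving away from it by `r - m` costs
`(r - m) ^ 2` times the total weight. -/
theorem sum_lik_sq_post_le (hC : C.Nonempty) (y : ι → ℝ) (r : ℝ) :
    ∑ c ∈ C, lik a (x c) y * (f c - post C a x f y) ^ 2 ≤
      ∑ c ∈ C, lik a (x c) y * (f c - r) ^ 2 := by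
  set m := post C a x f y
  have h := post_mul_sum (a := a) (x := x) (f := f) hC y
  have h2 : ∑ c ∈ C, lik a (x c) y * (f c - r) ^ 2 =
      ∑ c ∈ C, lik a (x c) y * (f c - m) ^ 2 + (r - m) ^ 2 * ∑ c ∈ C, lik a (x c) y := by
    have : ∀ c, lik a (x c) y * (f c - r) ^ 2 = lik a (x c) y * (f c - m) ^ 2 +
        ((r - m) ^ 2 * lik a (x c) y + (2 * (r - m) * m * lik a (x c) y
          - 2 * (r - m) * (f c * lik a (x c) y))) := fun c => by ring
    simp only [this, Finset.sum_add_distrib, Finset.sum_sub_distrib, ← Finset.mul_sum]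
    rw [← h]; ring
  rw [h2]
  have := mul_nonneg (sq_nonneg (r - m)) (sum_lik_pos hC a x y).le
  linarith

theorem sq_sub_bdd {h : ℝ} {B r : ℝ} (hB : |h| ≤ B) : |(r - h) ^ 2| ≤ (|r| + B) ^ 2 := by
  rw [abs_of_nonneg (sq_nonneg _), ← sq_abs]
  exact pow_le_pow_left₀ (abs_nonneg _) ((abs_sub r h).trans (by linarith)) 2

theorem mse_eq {h : (ι → ℝ) → ℝ} (hm : Measurable h) {B : ℝ} (hB : ∀ y, |h y| ≤ B) :
    mse C a x f h =
      (∫ y, ∑ c ∈ C, lik a (x c) y * (f c - h y) ^ 2 ∂stdNoise ι) / C.card := by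
  rw [mse, integral_finsetSum]
  · congr 1
    exact Finset.sum_congr rfl fun c _ =>
      integral_shift a (x c) (F := fun y => (f c - h y) ^ 2) (by fun_prop)
  · exact fun c _ => integrable_lik_mul a (x c) (F := fun y => (f c - h y) ^ 2) (by fun_prop)
      (fun y => sq_sub_bdd (hB y))

/-- The posterior mean is the estimate with the least mean squared error. -/
theorem mse_post_le (hC : C.Nonempty) {h : (ι → ℝ) → ℝ} (hm : Measurable h) {B : ℝ}
    (hB : ∀ y, |h y| ≤ B) : mse C a x f (post C a x f) ≤ mse C a x f h := by
  rw [mse_eq hm hB, mse_eq (continuous_post hC).measurable (abs_post_le hC)]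
  refine div_le_div_of_nonneg_right (integral_mono ?_ ?_ fun y => sum_lik_sq_post_le hC y _)
    (Nat.cast_nonneg _)
  · exact integrable_finsetSum _ fun c _ => integrable_lik_mul a (x c)
      (F := fun y => (f c - post C a x f y) ^ 2)
      (by have := (continuous_post (a := a) (x := x) (f := f) hC).measurable; fun_prop)
      (fun y => sq_sub_bdd (abs_post_le hC y))
  · exact integrable_finsetSum _ fun c _ => integrable_lik_mul a (x c)
      (F := fun y => (f c - h y) ^ 2) (by fun_prop) (fun y => sq_sub_bdd (hB y))

theorem sq_integral_le {E : Type*} [MeasurableSpace E] {μ : Measure E} [IsProbabilityMeasure μ]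
    {g : E → ℝ} (hg : Measurable g) {B : ℝ} (hB : ∀ y, |g y| ≤ B) :
    (∫ y, g y ∂μ) ^ 2 ≤ ∫ y, g y ^ 2 ∂μ := by
  have h1 : Integrable g μ := integrable_of_bdd_measurable hg hB
  have h2 : Integrable (fun y => g y ^ 2) μ :=
    integrable_of_bdd_measurable (by fun_prop) (B := B ^ 2) fun y => by
      rw [abs_pow]; exact pow_le_pow_left₀ (abs_nonneg _) (hB y) 2
  set m := ∫ y, g y ∂μ
  have h3 : 0 ≤ ∫ y, (g y - m) ^ 2 ∂μ := integral_nonneg fun y => sq_nonneg _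
  have h4 : ∫ y, (g y - m) ^ 2 ∂μ = (∫ y, g y ^ 2 ∂μ) - m ^ 2 := by
    have : ∀ y, (g y - m) ^ 2 = g y ^ 2 - (2 * m * g y - m ^ 2) := fun y => by ring
    simp only [this]
    have h5 : Integrable (fun y => 2 * m * g y - m ^ 2) μ :=
      (h1.const_mul _).sub (integrable_const _)
    rw [integral_sub h2 h5, integral_sub (h1.const_mul _) (integrable_const _), integral_const_mul]
    simp only [integral_const, probReal_univ, smul_eq_mul, one_mul]
    change _ - (2 * m * m - m ^ 2) = _
    ring
  linarith

/-- The least mean squared error does not increase with the signal to noise ratio. -/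
theorem mse_post_antitone (hC : C.Nonempty) {a b : ℝ} (ha : 0 ≤ a) (hab : a ≤ b) :
    mse C b x f (post C b x f) ≤ mse C a x f (post C a x f) := by
  rcases hab.eq_or_lt with rfl | hlt
  · exact le_rfl
  have hb : 0 < b := ha.trans_lt hlt
  -- The weaker channel is simulated from the stronger one: `p (b x + n) + q n'` equals `a x + (p n
  -- + q n')`, whose noise is again standard Gaussian.
  set p := a / b
  set q := √(1 - p ^ 2)
  have hp0 : 0 ≤ p := div_nonneg ha hb.le
  have hp1 : p ≤ 1 := (div_le_one hb).2 hab
  have hpq : p ^ 2 + q ^ 2 = 1 := by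
    rw [Real.sq_sqrt (by nlinarith)]; ring
  have hpb : p * b = a := div_mul_cancel₀ _ hb.ne'
  set P := post C a x f
  have hP : Continuous P := continuous_post hC
  set B := ∑ c ∈ C, |f c|
  have hPB : ∀ y, |P y| ≤ B := abs_post_le hC
  have hcont : Continuous (fun z : (ι → ℝ) × (ι → ℝ) => P fun j => p * z.1 j + q * z.2 j) := by
    fun_prop
  -- Averaging the weaker channel's estimate over the added noise `n'` gives a competitor on the
  -- stronger channel.
  set g : (ι → ℝ) → ℝ := fun y => ∫ n, P (fun j => p * y j + q * n j) ∂stdNoise ι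
  have hg : Measurable g := by
    have := hcont.measurable.stronglyMeasurable.integral_prod_right' (ν := stdNoise ι)
    exact this.measurable
  have hgB : ∀ y, |g y| ≤ B := fun y => by
    have := norm_integral_le_of_norm_le_const (μ := stdNoise ι)
      (f := fun n => P (fun j => p * y j + q * n j)) (ae_of_all _ fun n => hPB _)
    simpa using this
  refine (mse_post_le hC hg hgB).trans ?_
  unfold mse
  refine div_le_div_of_nonneg_right (Finset.sum_le_sum fun c _ => ?_) (Nat.cast_nonneg _)
  set F : (ι → ℝ) → ℝ := fun m => (f c - P fun j => a * x c j + m j) ^ 2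
  have hF : Continuous F := by fun_prop
  have hFB : ∀ m, |F m| ≤ (|f c| + B) ^ 2 := fun m => sq_sub_bdd (hPB _)
  have hrot := stdNoise_prod_map_rotation (ι := ι) hpq
  have e1 : ∫ m, F m ∂stdNoise ι =
      ∫ n, ∫ n', F (fun j => p * n j + q * n' j) ∂stdNoise ι ∂stdNoise ι := by
    rw [← hrot.map_eq, integral_map hrot.measurable.aemeasurable
      hF.aestronglyMeasurable, integral_prod]
    · rw [hrot.map_eq]
    · exact integrable_of_bdd_measurable (hF.measurable.comp hrot.measurable) fun z => hFB _
  rw [e1]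
  have hFr : Continuous (fun z : (ι → ℝ) × (ι → ℝ) => F fun j => p * z.1 j + q * z.2 j) := by
    fun_prop
  refine integral_mono ?_ ?_ fun n => ?_
  · refine integrable_of_bdd_measurable (by fun_prop) (B := (|f c| + B) ^ 2)
      fun n => sq_sub_bdd (hgB _)
  · refine integrable_of_bdd_measurable (B := (|f c| + B) ^ 2) ?_ fun n => ?_
    · exact (hFr.measurable.stronglyMeasurable.integral_prod_right' (ν := stdNoise ι)).measurable
    · have := norm_integral_le_of_norm_le_const (μ := stdNoise ι)
        (f := fun n' => F (fun j => p * n j + q * n' j)) (ae_of_all _ fun n' => hFB _)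
      simpa using this
  · have e2 : ∀ n' : ι → ℝ, (fun j => a * x c j + (p * n j + q * n' j)) =
        fun j => p * (b * x c j + n j) + q * n' j := fun n' => by
      ext j; rw [← hpb]; ring
    simp only [F, e2]
    have hc2 : Continuous (fun n' : ι → ℝ => P fun j => p * (b * x c j + n j) + q * n' j) := by
      fun_prop
    have h1 : f c - g (fun j => b * x c j + n j) =
        ∫ n', (f c - P fun j => p * (b * x c j + n j) + q * n' j) ∂stdNoise ι := by
      rw [integral_sub (integrable_const _)
        (integrable_of_bdd_measurable hc2.measurable fun y => hPB _)]
      simp [g]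
    rw [h1]
    -- Jensen's inequality: the average over `n'` does not increase the squared error.
    exact sq_integral_le (by fun_prop) (B := |f c| + B)
      fun n' => (abs_sub _ _).trans (by have := hPB fun j => p * (b * x c j + n j) + q * n' j
                                        linarith)

/-! ### Mutual information and mean squared error -/

theorem hasDerivAt_lik_amplitude (s n : ι → ℝ) (a : ℝ) :
    HasDerivAt (fun a => lik a s n) (lik a s n * ∑ j, (s j * n j - a * s j ^ 2)) a := by
  unfold lik
  refine HasDerivAt.exp ?_
  refine HasDerivAt.fun_sum fun j _ => ?_
  have h := (((hasDerivAt_id a).mul_const (s j)).mul_const (n j)).sub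
    ((((hasDerivAt_id a).mul_const (s j)).pow 2).div_const 2)
  refine h.congr_deriv ?_
  simp; ring

theorem hasDerivAt_lik_update [DecidableEq ι] (s n : ι → ℝ) (j : ι) (t : ℝ) :
    HasDerivAt (fun t => lik a s (Function.update n j t))
      (a * s j * lik a s (Function.update n j t)) t := by
  unfold lik
  rw [mul_comm]
  refine HasDerivAt.exp ?_
  have h : ∀ t, ∑ i, (a * s i * Function.update n j t i - (a * s i) ^ 2 / 2) =
      a * s j * t + (-(a * s j) ^ 2 / 2
        + ∑ i ∈ Finset.univ.erase j, (a * s i * n i - (a * s i) ^ 2 / 2)) := by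
    intro t
    rw [← Finset.add_sum_erase _ _ (Finset.mem_univ j), Function.update_self,
      Finset.sum_congr rfl fun i hi => by rw [Function.update_of_ne (Finset.ne_of_mem_erase hi)]]
    ring
  simp only [h]
  exact (((hasDerivAt_id' t).const_mul (a * s j)).add_const _).congr_deriv (mul_one _)

/-- The posterior is an exponential family in the observation, so the derivative of a posterior mean
is a posterior covariance. -/
theorem hasDerivAt_post_update [DecidableEq ι] (hC : C.Nonempty) (f : A → ℝ) (n : ι → ℝ) (j : ι)
    (t : ℝ) :
    HasDerivAt (fun t => post C a x f (Function.update n j t))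
      (a * (post C a x (fun c => f c * x c j) (Function.update n j t) -
        post C a x f (Function.update n j t) * post C a x (fun c => x c j) (Function.update n j t)))
      t := by
  have h1 : HasDerivAt (fun t => ∑ c ∈ C, f c * lik a (x c) (Function.update n j t))
      (∑ c ∈ C, f c * (a * x c j * lik a (x c) (Function.update n j t))) t :=
    HasDerivAt.fun_sum fun c _ => (hasDerivAt_lik_update (x c) n j t).const_mul (f c)
  have h2 : HasDerivAt (fun t => ∑ c ∈ C, lik a (x c) (Function.update n j t))
      (∑ c ∈ C, a * x c j * lik a (x c) (Function.update n j t)) t :=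
    HasDerivAt.fun_sum fun c _ => hasDerivAt_lik_update (x c) n j t
  have hpos := (sum_lik_pos hC a x (Function.update n j t)).ne'
  refine (h1.div h2 hpos).congr_deriv ?_
  simp only [post]
  have e1 : ∑ c ∈ C, f c * (a * x c j * lik a (x c) (Function.update n j t)) =
      a * ∑ c ∈ C, f c * x c j * lik a (x c) (Function.update n j t) := by
    rw [Finset.mul_sum]; exact Finset.sum_congr rfl fun c _ => by ring
  have e2 : ∑ c ∈ C, a * x c j * lik a (x c) (Function.update n j t) =
      a * ∑ c ∈ C, x c j * lik a (x c) (Function.update n j t) := by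
    rw [Finset.mul_sum]; exact Finset.sum_congr rfl fun c _ => by ring
  rw [e1, e2]
  field_simp

theorem integral_eval_mul_post (hC : C.Nonempty) (j : ι) :
    ∫ n, n j * post C a x f n ∂stdNoise ι =
      ∫ n, a * (post C a x (fun c => f c * x c j) n -
        post C a x f n * post C a x (fun c => x c j) n) ∂stdNoise ι := by
  classical
  have hc : ∀ g : A → ℝ, Continuous (post C a x g) := fun g => continuous_post hC
  refine integral_eval_mul_stdNoise j (fun n t => hasDerivAt_post_update hC f n j t)
    (hc f).measurable ?_ (abs_post_le hC) (B' := |a| * ((∑ c ∈ C, |f c * x c j|)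
      + (∑ c ∈ C, |f c|) * ∑ c ∈ C, |x c j|)) fun n => ?_
  · have := (hc f).measurable
    have := (hc fun c => f c * x c j).measurable
    have := (hc fun c => x c j).measurable
    fun_prop
  · rw [abs_mul]
    refine mul_le_mul_of_nonneg_left ?_ (abs_nonneg a)
    refine (abs_sub _ _).trans (add_le_add (abs_post_le hC n) ?_)
    rw [abs_mul]
    exact mul_le_mul (abs_post_le hC n) (abs_post_le hC n) (abs_nonneg _)
      (Finset.sum_nonneg fun c _ => abs_nonneg _)

/-- Completing the square gives `lik ≤ exp (∑ n j ^ 2 / 2)`. The bound does not depend on `a`, which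
makes it a dominating function as `a → ∞`. -/
theorem log_sum_lik_le (hC : C.Nonempty) (a : ℝ) (x : A → ι → ℝ) (n : ι → ℝ) :
    Real.log (∑ c ∈ C, lik a (x c) n) ≤ Real.log C.card + ∑ j, n j ^ 2 / 2 := by
  rw [← Real.log_exp (∑ j, n j ^ 2 / 2), ← Real.log_mul
    (by exact_mod_cast hC.card_pos.ne') (Real.exp_pos _).ne']
  refine Real.log_le_log (sum_lik_pos hC a x n) ?_
  rw [← nsmul_eq_mul]
  refine Finset.sum_le_card_nsmul _ _ _ fun c _ => ?_
  refine Real.exp_le_exp.2 (Finset.sum_le_sum fun j _ => ?_)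
  nlinarith [sq_nonneg (a * x c j - n j)]

theorem abs_log_sum_lik_le (hC : C.Nonempty) (a : ℝ) (x : A → ι → ℝ) (n : ι → ℝ) :
    |Real.log (∑ c ∈ C, lik a (x c) n)| ≤
      Real.log C.card + ∑ j, n j ^ 2 / 2 + ∑ c ∈ C, ∑ j, (|a * x c j * n j| + (a * x c j) ^ 2) := by
  have hup := log_sum_lik_le hC a x n
  have h0 : 0 ≤ Real.log C.card := Real.log_natCast_nonneg _
  have h1 : 0 ≤ ∑ j, n j ^ 2 / 2 := Finset.sum_nonneg fun j _ => by positivity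
  have h2 : ∀ c ∈ C, 0 ≤ ∑ j, (|a * x c j * n j| + (a * x c j) ^ 2) := fun c _ =>
    Finset.sum_nonneg fun j _ => by positivity
  rw [abs_le]
  refine ⟨?_, by linarith [Finset.sum_nonneg h2]⟩
  obtain ⟨c, hc⟩ := hC
  have h3 := Finset.single_le_sum h2 hc
  have h4 : Real.log (lik a (x c) n) ≤ Real.log (∑ c ∈ C, lik a (x c) n) :=
    Real.log_le_log (lik_pos a (x c) n)
      (Finset.single_le_sum (f := fun c => lik a (x c) n) (fun c _ => (lik_pos a (x c) n).le) hc)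
  rw [lik, Real.log_exp] at h4
  have h5 : -∑ j, (|a * x c j * n j| + (a * x c j) ^ 2) ≤
      ∑ j, (a * x c j * n j - (a * x c j) ^ 2 / 2) := by
    rw [← Finset.sum_neg_distrib]
    refine Finset.sum_le_sum fun j _ => ?_
    nlinarith [neg_abs_le (a * x c j * n j), sq_nonneg (a * x c j)]
  linarith

theorem continuous_log_sum_lik (hC : C.Nonempty) (a : ℝ) (x : A → ι → ℝ) :
    Continuous (fun n => Real.log (∑ c ∈ C, lik a (x c) n)) :=
  (continuous_finsetSum _ fun c _ => continuous_lik a (x c)).log fun n => (sum_lik_pos hC a x n).ne'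

theorem integrable_log_sum_lik (hC : C.Nonempty) (a : ℝ) (x : A → ι → ℝ) :
    Integrable (fun n => Real.log (∑ c ∈ C, lik a (x c) n)) (stdNoise ι) := by
  refine Integrable.mono' (g := fun n => Real.log C.card + ∑ j, n j ^ 2 / 2
    + ∑ c ∈ C, ∑ j, (|a * x c j * n j| + (a * x c j) ^ 2)) ?_
    (continuous_log_sum_lik hC a x).aestronglyMeasurable
    (ae_of_all _ fun n => abs_log_sum_lik_le hC a x n)
  refine ((integrable_const _).add (integrable_finsetSum _ fun j _ =>
    (integrable_eval_sq_stdNoise j).div_const 2)).add (integrable_finsetSum _ fun c _ =>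
      integrable_finsetSum _ fun j _ => ?_)
  exact ((integrable_eval_stdNoise j).const_mul _).abs.add (integrable_const _)

/-- Derivative of the expected log-likelihood with respect to the amplitude of the signal. -/
theorem hasDerivAt_integral_log_sum_lik (hC : C.Nonempty) (x : A → ι → ℝ) (a : ℝ) :
    HasDerivAt (fun a => ∫ n, Real.log (∑ c ∈ C, lik a (x c) n) ∂stdNoise ι)
      (-a * ∑ j, ∫ n, post C a x (fun c => x c j) n ^ 2 ∂stdNoise ι) a := by
  have hc : ∀ (a : ℝ) (g : A → ℝ), Continuous (post C a x g) := fun a g => continuous_post hC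
  set F' : ℝ → (ι → ℝ) → ℝ := fun a n => ∑ j, (n j * post C a x (fun c => x c j) n
    - a * post C a x (fun c => x c j * x c j) n)
  have hd : ∀ a n, HasDerivAt (fun a => Real.log (∑ c ∈ C, lik a (x c) n)) (F' a n) a := by
    intro a n
    have h := (HasDerivAt.fun_sum fun c (_ : c ∈ C) => hasDerivAt_lik_amplitude (x c) n a).log
      (sum_lik_pos hC a x n).ne'
    refine h.congr_deriv ?_
    simp only [F', ← post_const_mul, sub_eq_add_neg]
    have e : ∀ j, post C a x (fun c => n j * x c j) n + -(post C a x (fun c => a * (x c j * x c j)) n)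
        = post C a x (fun c => n j * x c j + (-1) * (a * (x c j * x c j))) n := fun j => by
      rw [post_add, post_const_mul (-1)]; ring
    simp only [e]
    rw [← post_sum, post]
    congr 1
    refine Finset.sum_congr rfl fun c _ => ?_
    rw [mul_comm]
    congr 1
    exact Finset.sum_congr rfl fun j _ => by ring
  have hF'm : ∀ a, Continuous (F' a) := fun a =>
    continuous_finsetSum _ fun j _ => ((continuous_apply j).mul (hc a _)).sub
      (continuous_const.mul (hc a _))
  have key := hasDerivAt_integral_of_dominated_loc_of_deriv_le (μ := stdNoise ι)
    (F := fun a n => Real.log (∑ c ∈ C, lik a (x c) n)) (F' := F') (x₀ := a)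
    -- On the unit ball around `a` amplitudes are at most `|a| + 1`, the factor in the bound.
    (s := Metric.ball a 1)
    (bound := fun n => ∑ j, (|n j| * (∑ c ∈ C, |x c j|) + (|a| + 1) * ∑ c ∈ C, |x c j * x c j|))
    (Metric.ball_mem_nhds a one_pos)
    (Eventually.of_forall fun b => (continuous_log_sum_lik hC b x).aestronglyMeasurable)
    (integrable_log_sum_lik hC a x) (hF'm a).aestronglyMeasurable
    (ae_of_all _ fun n b hb => ?_) ?_ (ae_of_all _ fun n b _ => hd b n)
  · refine key.2.congr_deriv ?_
    simp only [F']
    have hi1 : ∀ j, Integrable (fun n => n j * post C a x (fun c => x c j) n) (stdNoise ι) :=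
      fun j => (integrable_eval_stdNoise j).mul_bdd (c := ∑ c ∈ C, |x c j|)
        (hc a _).aestronglyMeasurable (ae_of_all _ (abs_post_le hC))
    have hi2 : ∀ g : A → ℝ, Integrable (post C a x g) (stdNoise ι) := fun g =>
      integrable_of_bdd_measurable (hc a g).measurable (abs_post_le hC)
    have hi3 : ∀ j, Integrable (fun n => n j * post C a x (fun c => x c j) n
        - a * post C a x (fun c => x c j * x c j) n) (stdNoise ι) :=
      fun j => (hi1 j).sub ((hi2 _).const_mul a)
    rw [integral_finsetSum _ fun j _ => hi3 j, Finset.mul_sum]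
    refine Finset.sum_congr rfl fun j _ => ?_
    -- Integration by parts turns the linear term into `a` times the posterior variance. Its second
    -- moment cancels the quadratic term, and only `-a` times the squared posterior mean remains.
    rw [integral_sub (hi1 j) ((hi2 _).const_mul a), integral_eval_mul_post hC,
      ← integral_const_mul, ← integral_sub]
    · congr 1; ext n; ring
    · refine ((hi2 _).sub ?_).const_mul a
      exact (hi2 _).mul_bdd (c := ∑ c ∈ C, |x c j|) (hc a _).aestronglyMeasurable
        (ae_of_all _ (abs_post_le hC))
    · exact (hi2 _).const_mul a
  · refine (Finset.abs_sum_le_sum_abs _ _).trans (Finset.sum_le_sum fun j _ => ?_)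
    refine (abs_sub _ _).trans (add_le_add ?_ ?_)
    · rw [abs_mul]
      exact mul_le_mul_of_nonneg_left (abs_post_le hC n) (abs_nonneg _)
    · rw [abs_mul]
      refine mul_le_mul ?_ (abs_post_le hC n) (abs_nonneg _) (by positivity)
      have h1 : |b - a| < 1 := hb
      have := abs_sub_abs_le_abs_sub b a
      linarith
  · exact integrable_finsetSum _ fun j _ =>
      ((integrable_eval_stdNoise j).abs.mul_const _).add (integrable_const _)

theorem tendsto_lik_atTop {s : ι → ℝ} (hs : s ≠ 0) (n : ι → ℝ) :
    Tendsto (fun a => lik a s n) atTop (𝓝 0) := by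
  have hq : 0 < ∑ j, s j ^ 2 / 2 := by
    obtain ⟨j, hj⟩ := Function.ne_iff.1 hs
    refine Finset.sum_pos' (fun j _ => by positivity) ⟨j, Finset.mem_univ j, ?_⟩
    have : s j ≠ 0 := hj
    positivity
  set q := ∑ j, s j ^ 2 / 2
  set l := ∑ j, s j * n j
  have e : ∀ a, lik a s n = Real.exp (a * (l - a * q)) := by
    intro a
    rw [lik]
    congr 1
    simp only [l, q, Finset.mul_sum, ← Finset.sum_sub_distrib]
    exact Finset.sum_congr rfl fun j _ => by ring
  simp only [e]
  refine Real.tendsto_exp_atBot.comp ?_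
  refine Tendsto.atTop_mul_atBot₀ tendsto_id ?_
  exact tendsto_atBot_add_const_left _ l
    (tendsto_neg_atTop_atBot.comp (tendsto_id.atTop_mul_const hq))

/-- The zero signal plays the transmitted message. Its likelihood is identically `1`, which keeps
the logarithm nonnegative, while all other likelihoods vanish in the limit. -/
theorem tendsto_integral_log_sum_lik [DecidableEq A] {c₀ : A} (hc₀ : c₀ ∈ C) (h0 : x c₀ = 0)
    (hne : ∀ c ∈ C, c ≠ c₀ → x c ≠ 0) :
    Tendsto (fun a => ∫ n, Real.log (∑ c ∈ C, lik a (x c) n) ∂stdNoise ι) atTop (𝓝 0) := by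
  have hC : C.Nonempty := ⟨c₀, hc₀⟩
  have h1 : ∀ a n, lik a (x c₀) n = 1 := fun a n => by simp [lik, h0]
  have := tendsto_integral_filter_of_dominated_convergence (μ := stdNoise ι) (l := atTop)
    (F := fun a n => Real.log (∑ c ∈ C, lik a (x c) n)) (f := fun _ => (0 : ℝ))
    (fun n => Real.log C.card + ∑ j, n j ^ 2 / 2)
    (Eventually.of_forall fun b => (continuous_log_sum_lik hC b x).aestronglyMeasurable)
    (Eventually.of_forall fun b => ae_of_all _ fun n => ?_) ?_ (ae_of_all _ fun n => ?_)
  · simpa using this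
  · rw [Real.norm_eq_abs, abs_of_nonneg]
    · exact log_sum_lik_le hC b x n
    · refine Real.log_nonneg ?_
      rw [← h1 b n]
      exact Finset.single_le_sum (f := fun c => lik b (x c) n) (fun c _ => (lik_pos b (x c) n).le) hc₀
  · exact (integrable_const _).add (integrable_finsetSum _ fun j _ =>
      (integrable_eval_sq_stdNoise j).div_const 2)
  · rw [← Real.log_one]
    refine Tendsto.log ?_ one_ne_zero
    have e : ∀ a, ∑ c ∈ C, lik a (x c) n = 1 + ∑ c ∈ C.erase c₀, lik a (x c) n := fun a => by
      rw [← Finset.add_sum_erase _ _ hc₀, h1]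
    simp only [e]
    have : Tendsto (fun a => ∑ c ∈ C.erase c₀, lik a (x c) n) atTop
        (𝓝 (∑ c ∈ C.erase c₀, (0 : ℝ))) :=
      tendsto_finsetSum _ fun c hc => tendsto_lik_atTop
        (hne c (Finset.mem_of_mem_erase hc) (Finset.ne_of_mem_erase hc)) n
    simpa using this.const_add 1

/-- Recentring at the transmitted signal `s₀` changes all likelihoods by a factor independent of
`s`, which cancels in posteriors; the observation becomes pure noise. -/
theorem lik_shift (a : ℝ) (s s₀ n : ι → ℝ) :
    lik a s (fun j => a * s₀ j + n j) = lik a (s - s₀) n * lik a s₀ (fun j => a * s₀ j + n j) := by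
  unfold lik
  rw [← Real.exp_add, ← Finset.sum_add_distrib]
  congr 1
  refine Finset.sum_congr rfl fun j _ => ?_
  simp only [Pi.sub_apply]
  ring

theorem post_shift (a : ℝ) (x : A → ι → ℝ) (f : A → ℝ) (s₀ n : ι → ℝ) :
    post C a x f (fun j => a * s₀ j + n j) = post C a (fun c => x c - s₀) f n := by
  obtain ⟨K, hK, e⟩ : ∃ K : ℝ, K ≠ 0 ∧ ∀ c,
      lik a (x c) (fun j => a * s₀ j + n j) = lik a (x c - s₀) n * K :=
    ⟨_, (lik_pos _ _ _).ne', fun c => lik_shift a (x c) s₀ n⟩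
  simp only [post, e, ← mul_assoc, ← Finset.sum_mul]
  exact mul_div_mul_right _ _ hK

/-- The total least mean squared error of distinct signals, integrated over all signal to noise
ratios, is twice their entropy. -/
theorem integral_sum_mse_post (hC : C.Nonempty) (hx : Set.InjOn x C) :
    IntegrableOn (fun γ : ℝ => ∑ j, mse C (√γ) x (fun c => x c j)
        (post C (√γ) x fun c => x c j)) (Ioi 0) ∧
      ∫ γ in Ioi (0 : ℝ), ∑ j, mse C (√γ) x (fun c => x c j) (post C (√γ) x fun c => x c j) =
        2 * Real.log C.card := by
  classical
  have hcard : (0 : ℝ) < C.card := by exact_mod_cast hC.card_pos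
  -- `G a` is the conditional entropy of the message given the observation at amplitude `a`: the
  -- summand is the mean of minus the log posterior of `c₀` when `c₀` is sent.
  set G : ℝ → ℝ := fun a => (∑ c₀ ∈ C, ∫ n, Real.log (∑ c ∈ C, lik a (x c - x c₀) n) ∂stdNoise ι)
    / C.card
  set M : ℝ → ℝ := fun a => ∑ j, mse C a x (fun c => x c j) (post C a x fun c => x c j)
  have hG : ∀ a, HasDerivAt G (-a * M a) a := by
    intro a
    have h : HasDerivAt (fun a => ∑ c₀ ∈ C, ∫ n, Real.log (∑ c ∈ C, lik a (x c - x c₀) n)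
        ∂stdNoise ι) (∑ c₀ ∈ C, -a * ∑ j, ∫ n, post C a (fun c => x c - x c₀)
          (fun c => (x c - x c₀) j) n ^ 2 ∂stdNoise ι) a :=
      HasDerivAt.fun_sum fun c₀ _ => hasDerivAt_integral_log_sum_lik hC (fun c => x c - x c₀) a
    refine (h.div_const (C.card : ℝ)).congr_deriv ?_
    simp only [M, mse]
    rw [← Finset.mul_sum, mul_div_assoc, ← Finset.sum_div, Finset.sum_comm]
    congr 2
    refine Finset.sum_congr rfl fun j _ => Finset.sum_congr rfl fun c₀ _ => ?_
    congr 1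
    ext n
    -- After recentring, the posterior mean of `x c - x c₀` is minus the estimation error when `c₀`
    -- is sent.
    rw [post_shift]
    have : (fun c => (x c - x c₀) j) = fun c => x c j + -(x c₀ j) := by
      ext c; simp [sub_eq_add_neg]
    rw [this, post_add, post_const hC]
    ring
  have hG0 : G 0 = Real.log C.card := by
    simp [G, lik]
    field_simp
  have hGtop : Tendsto G atTop (𝓝 0) := by
    have : Tendsto G atTop (𝓝 ((∑ c₀ ∈ C, (0 : ℝ)) / C.card)) := by
      refine Tendsto.div_const (tendsto_finsetSum _ fun c₀ hc₀ => ?_) _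
      refine tendsto_integral_log_sum_lik (x := fun c => x c - x c₀) hc₀ (sub_self _) ?_
      intro c hc hne h
      exact hne (hx hc hc₀ (sub_eq_zero.1 h))
    simpa using this
  have hM0 : ∀ a, 0 ≤ M a := fun a => Finset.sum_nonneg fun j _ =>
    div_nonneg (Finset.sum_nonneg fun c _ => integral_nonneg fun n => sq_nonneg _) hcard.le
  -- The derivative `1 / (2 √γ)` of the square root absorbs the amplitude factor in `G'`.
  have hd : ∀ γ ∈ Ioi (0 : ℝ), HasDerivAt (fun γ => G √γ) (-(1 / 2) * M √γ) γ := by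
    intro γ hγ
    have h := (hG √γ).comp γ (Real.hasDerivAt_sqrt (ne_of_gt hγ))
    refine h.congr_deriv ?_
    have : √γ ≠ 0 := (Real.sqrt_pos.2 hγ).ne'
    field_simp
  have hcont : ContinuousWithinAt (fun γ => G √γ) (Ici 0) 0 := by
    have h1 : Continuous G := continuous_iff_continuousAt.2 fun a => (hG a).continuousAt
    exact (h1.comp Real.continuous_sqrt).continuousWithinAt
  have hneg : ∀ γ ∈ Ioi (0 : ℝ), -(1 / 2) * M √γ ≤ 0 := fun γ _ => by
    have := hM0 √γ; linarith
  have hlim : Tendsto (fun γ => G √γ) atTop (𝓝 0) := hGtop.comp Real.tendsto_sqrt_atTop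
  have hint := integrableOn_Ioi_deriv_of_nonpos hcont hd hneg hlim
  have hval := integral_Ioi_of_hasDerivAt_of_nonpos hcont hd hneg hlim
  refine ⟨?_, ?_⟩
  · refine (hint.const_mul (-2)).congr (ae_of_all _ fun γ => ?_)
    change -2 * (-(1 / 2) * M √γ) = M √γ
    ring
  · rw [integral_const_mul, Real.sqrt_zero, hG0] at hval
    change ∫ γ in Ioi (0 : ℝ), M √γ = _
    linarith

end MSEChart

namespace MSEChart

/-! ### Uniform messages and independent noise -/

theorem measurableEmbedding_prodMk {A E : Type*} [MeasurableSpace A] [MeasurableSingletonClass A]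
    [MeasurableSpace E] (c : A) : MeasurableEmbedding (Prod.mk c : E → A × E) :=
  MeasurableEmbedding.id.prodMk_left c

section Uniform

variable {A : Type*} [Fintype A] [MeasurableSpace A] [MeasurableSingletonClass A]
  {E : Type*} [MeasurableSpace E] {ν : Measure E} [IsProbabilityMeasure ν] {C : Finset A}

theorem uniformOn_prod_eq (C : Finset A) (ν : Measure E) [IsProbabilityMeasure ν] :
    (uniformOn (C : Set A)).prod ν = (C.card : ℝ≥0∞)⁻¹ • ∑ c ∈ C, ν.map (Prod.mk c) := by
  classical
  rcases C.eq_empty_or_nonempty with rfl | hC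
  · simp [uniformOn_empty_meas]
  have := isProbabilityMeasure_uniformOn C.finite_toSet hC
  refine Measure.prod_eq fun s t hs ht => ?_
  have h1 : uniformOn (C : Set A) s = ((C ∩ s.toFinset).card : ℝ≥0∞) / C.card := by
    rw [← uniformOn_apply_finset, coe_toFinset]
  rw [h1, Measure.smul_apply, Measure.finsetSum_apply]
  have h2 : ∀ c ∈ C, (ν.map (Prod.mk c)) (s ×ˢ t) = if c ∈ s then ν t else 0 := by
    intro c _
    rw [Measure.map_apply measurable_prodMk_left (hs.prod ht)]
    split_ifs with h
    · congr 1; ext y; simp [h]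
    · rw [← measure_empty (μ := ν)]; congr 1; ext y; simp [h]
  rw [Finset.sum_congr rfl h2, ← Finset.sum_filter, Finset.sum_const, nsmul_eq_mul, smul_eq_mul]
  have h3 : C.filter (· ∈ s) = C ∩ s.toFinset := by ext; simp
  rw [h3, ENNReal.div_eq_inv_mul, mul_assoc]

theorem integral_uniformOn_prod {F : A × E → ℝ} (hF : ∀ c ∈ C, Integrable (fun e => F (c, e)) ν) :
    ∫ ω, F ω ∂(uniformOn (C : Set A)).prod ν = (∑ c ∈ C, ∫ e, F (c, e) ∂ν) / C.card := by
  rw [uniformOn_prod_eq, integral_smul_measure, integral_finsetSum_measure]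
  · simp only [(measurableEmbedding_prodMk _).integral_map]
    simp [div_eq_inv_mul]
  · exact fun c hc => (measurableEmbedding_prodMk c).integrable_map_iff.2 (hF c hc)

theorem integrable_uniformOn_prod (hC : C.Nonempty) {F : A × E → ℝ}
    (hF : ∀ c ∈ C, Integrable (fun e => F (c, e)) ν) :
    Integrable F ((uniformOn (C : Set A)).prod ν) := by
  rw [uniformOn_prod_eq]
  refine Integrable.smul_measure ?_ (by simpa using hC.ne_empty)
  exact integrable_finsetSum_measure.2 fun c hc =>
    (measurableEmbedding_prodMk c).integrable_map_iff.2 (hF c hc)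

/-- Bayes' rule: the conditional expectation of a function of a uniform message, given an
observation which has a density under each message. -/
theorem condExp_uniformOn_prod (hC : C.Nonempty) {E' : Type*} [MeasurableSpace E']
    {ν' : Measure E'} {O : A × E → E'} (hO : Measurable O) {l : A → E' → ℝ}
    (hl : ∀ c, Measurable (l c)) (hpos : ∀ c y, 0 < l c y)
    (hmap : ∀ c, ν.map (fun e => O (c, e)) = ν'.withDensity fun y => ENNReal.ofReal (l c y))
    (f : A → ℝ) :
    ((uniformOn (C : Set A)).prod ν)[fun ω => f ω.1 | MeasurableSpace.comap O inferInstance]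
      =ᵐ[(uniformOn (C : Set A)).prod ν]
      fun ω => (∑ c ∈ C, f c * l c (O ω)) / ∑ c ∈ C, l c (O ω) := by
  have := isProbabilityMeasure_uniformOn C.finite_toSet hC
  set μ := (uniformOn (C : Set A)).prod ν
  set g : E' → ℝ := fun y => (∑ c ∈ C, f c * l c y) / ∑ c ∈ C, l c y
  have hsum : ∀ y, 0 < ∑ c ∈ C, l c y := fun y => Finset.sum_pos (fun c _ => hpos c y) hC
  have hg : Measurable g := by fun_prop
  have hgB : ∀ y, |g y| ≤ ∑ c ∈ C, |f c| := by
    intro y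
    rw [abs_div, abs_of_pos (hsum y), div_le_iff₀ (hsum y), Finset.mul_sum]
    refine (Finset.abs_sum_le_sum_abs _ _).trans (Finset.sum_le_sum fun c hc => ?_)
    rw [abs_mul, abs_of_pos (hpos c y)]
    exact mul_le_mul_of_nonneg_right (abs_le_sum_abs f c hc) (hpos c y).le
  have hOc : ∀ c, Measurable fun e => O (c, e) := fun c => hO.comp measurable_prodMk_left
  have hlint : ∀ c, Integrable (l c) ν' := by
    intro c
    have hp : IsProbabilityMeasure (ν.map fun e => O (c, e)) :=
      Measure.isProbabilityMeasure_map (hOc c).aemeasurable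
    rw [hmap c] at hp
    have h1 := hp.measure_univ
    rw [withDensity_apply _ MeasurableSet.univ, Measure.restrict_univ] at h1
    refine ⟨(hl c).aestronglyMeasurable, ?_⟩
    rw [hasFiniteIntegral_iff_ofReal (ae_of_all _ fun y => (hpos c y).le), h1]
    exact ENNReal.one_lt_top
  have hchange : ∀ c, ∀ G : E' → ℝ, Measurable G →
      ∫ e, G (O (c, e)) ∂ν = ∫ y, l c y * G y ∂ν' := by
    intro c G hG
    rw [← integral_map (f := G) (hOc c).aemeasurable hG.aestronglyMeasurable, hmap c,
      integral_withDensity_eq_integral_toReal_smul (hl c).ennreal_ofReal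
        (ae_of_all _ fun _ => ENNReal.ofReal_lt_top)]
    simp only [ENNReal.toReal_ofReal (hpos c _).le, smul_eq_mul]
  have hfi : Integrable (fun ω : A × E => f ω.1) μ :=
    integrable_uniformOn_prod hC fun c _ => integrable_const (f c)
  have hgO : Integrable (fun ω => g (O ω)) μ :=
    integrable_of_bdd_measurable (hg.comp hO) fun ω => hgB _
  have hm : MeasurableSpace.comap O inferInstance ≤
      (inferInstance : MeasurableSpace (A × E)) := hO.comap_le
  symm
  refine ae_eq_condExp_of_forall_setIntegral_eq hm hfi (fun s _ _ => hgO.integrableOn) ?_ ?_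
  · rintro s ⟨B, hB, rfl⟩ _
    have hs : MeasurableSet (O ⁻¹' B) := hO hB
    rw [← integral_indicator hs, ← integral_indicator hs]
    have i1 : ∀ ω, (O ⁻¹' B).indicator (fun ω => g (O ω)) ω = B.indicator g (O ω) := fun ω => rfl
    have i2 : ∀ ω, (O ⁻¹' B).indicator (fun ω => f ω.1) ω
        = f ω.1 * B.indicator (fun _ => (1 : ℝ)) (O ω) := fun ω => by
      by_cases h : O ω ∈ B
      · rw [indicator_of_mem (by exact h), indicator_of_mem h, mul_one]
      · rw [indicator_of_notMem (by exact h), indicator_of_notMem h, mul_zero]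
    change ∫ ω, (O ⁻¹' B).indicator (fun ω => g (O ω)) ω ∂μ = _
    simp only [i1, i2]
    have hgBm : Measurable (B.indicator g) := hg.indicator hB
    have h1m : Measurable (B.indicator fun _ => (1 : ℝ)) := measurable_const.indicator hB
    have h1b : ∀ y, |B.indicator (fun _ => (1 : ℝ)) y| ≤ 1 := fun y => by
      by_cases h : y ∈ B <;> simp [h]
    have hgb : ∀ y, |B.indicator g y| ≤ ∑ c ∈ C, |f c| := fun y => by
      by_cases h : y ∈ B
      · simpa [h] using hgB y
      · simpa [h] using Finset.sum_nonneg fun c _ => abs_nonneg (f c)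
    rw [integral_uniformOn_prod (F := fun ω => B.indicator g (O ω)) fun c _ =>
        integrable_of_bdd_measurable (hgBm.comp (hOc c)) fun e => hgb _,
      integral_uniformOn_prod (F := fun ω => f ω.1 * B.indicator (fun _ => (1 : ℝ)) (O ω))
        fun c _ => (integrable_of_bdd_measurable (h1m.comp (hOc c)) fun e => h1b _).const_mul (f c)]
    congr 1
    simp only [integral_const_mul]
    -- Under each message the integral moves to `ν'` with weight `l c`; summed over messages, the
    -- weights cancel the denominator of `g` pointwise.
    have c1 := fun c => hchange c _ hgBm
    have c2 : ∀ c, f c * ∫ e, B.indicator (fun _ => (1 : ℝ)) (O (c, e)) ∂ν =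
        ∫ y, f c * (l c y * B.indicator (fun _ => (1 : ℝ)) y) ∂ν' := fun c => by
      rw [hchange c _ h1m, ← integral_const_mul]
    simp only [c1, c2]
    rw [← integral_finsetSum, ← integral_finsetSum]
    · congr 1
      ext y
      by_cases h : y ∈ B
      · simp only [indicator_of_mem h, mul_one, ← Finset.sum_mul]
        exact mul_div_cancel₀ _ (hsum y).ne'
      · simp only [indicator_of_notMem h, mul_zero]
    · exact fun c _ => ((hlint c).mul_bdd (c := 1) h1m.aestronglyMeasurable
        (ae_of_all _ h1b)).const_mul _
    · exact fun c _ => (hlint c).mul_bdd hgBm.aestronglyMeasurable (ae_of_all _ hgb)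
  · exact ((hg.comp (comap_measurable O)).stronglyMeasurable).aestronglyMeasurable

end Uniform

/-! ### The single bit -/

/-- The mean of an antipodal bit whose log likelihood ratio is `t`. -/
noncomputable def llrMean (t : ℝ) : ℝ := 1 - 2 / (1 + Real.exp t)

theorem continuous_llrMean : Continuous llrMean := by
  unfold llrMean
  exact continuous_const.sub (continuous_const.div (by fun_prop) fun t => by positivity)

theorem abs_llrMean_le (t : ℝ) : |llrMean t| ≤ 1 := by
  have h : 0 < 1 + Real.exp t := by positivity
  have h1 : 2 / (1 + Real.exp t) ≤ 2 := by
    rw [div_le_iff₀ h]; linarith [Real.exp_pos t]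
  have h2 : 0 ≤ 2 / (1 + Real.exp t) := by positivity
  rw [abs_le, llrMean]
  constructor <;> linarith

theorem llrMean_neg (t : ℝ) : llrMean (-t) = -llrMean t := by
  have := Real.exp_pos t
  rw [llrMean, llrMean, Real.exp_neg]
  field_simp
  ring

theorem llrMean_two_mul (t : ℝ) :
    llrMean (2 * t) = (Real.exp t - Real.exp (-t)) / (Real.exp t + Real.exp (-t)) := by
  have := Real.exp_pos t
  rw [llrMean, Real.exp_neg, two_mul, Real.exp_add]
  field_simp
  ring

theorem bpsk_sq (b : Bool) : bpsk b ^ 2 = 1 := by cases b <;> simp [bpsk]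

theorem abs_bpsk (b : Bool) : |bpsk b| = 1 := by cases b <;> simp [bpsk]

theorem coe_univ_bool : ((Finset.univ : Finset Bool) : Set Bool) = Set.univ := Finset.coe_univ

theorem integral_bitLaw {F : Bool × ℝ → ℝ} (hF : ∀ b, Integrable (fun n => F (b, n)) (gaussianReal 0 1)) :
    ∫ ω, F ω ∂bitLaw =
      (∫ n, F (true, n) ∂gaussianReal 0 1 + ∫ n, F (false, n) ∂gaussianReal 0 1) / 2 := by
  rw [bitLaw, ← coe_univ_bool, integral_uniformOn_prod fun b _ => hF b]
  simp

theorem measurable_bitOutput (γ : ℝ≥0) : Measurable (bitOutput γ) := by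
  unfold bitOutput
  have : Measurable bpsk := measurable_of_countable _
  fun_prop

theorem bitEstimate_ae (γ : ℝ≥0) :
    bitEstimate γ =ᵐ[bitLaw] fun ω => llrMean (2 * √(γ : ℝ) * bitOutput γ ω) := by
  have h := condExp_uniformOn_prod (A := Bool) (C := Finset.univ) (ν := gaussianReal 0 1)
    (ν' := gaussianReal 0 1) Finset.univ_nonempty (measurable_bitOutput γ)
    (l := fun b y => Real.exp (√(γ : ℝ) * bpsk b * y - (√(γ : ℝ) * bpsk b) ^ 2 / 2))
    (fun b => by fun_prop) (fun b y => Real.exp_pos _)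
    (fun b => gaussianReal_map_add_withDensity (√(γ : ℝ) * bpsk b)) bpsk
  rw [coe_univ_bool] at h
  refine h.trans (ae_of_all _ fun ω => ?_)
  simp only [Fintype.sum_bool]
  set y := bitOutput γ ω
  rw [mul_assoc 2, llrMean_two_mul]
  simp only [bpsk, if_true, Bool.false_eq_true, if_false, mul_one, one_mul, Real.exp_sub, mul_neg,
    neg_mul, neg_sq]
  have := Real.exp_pos (√(γ : ℝ) ^ 2 / 2)
  rw [← sub_eq_add_neg, ← sub_div, ← add_div, div_div_div_cancel_right₀ this.ne']

/-- Mean squared error of the optimal estimate of the bit. -/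
theorem phi_coe (γ : ℝ≥0) : phi γ =
    ∫ ω, (bpsk ω.1 - llrMean (2 * √(γ : ℝ) * bitOutput γ ω)) ^ 2 ∂bitLaw := by
  rw [phi, if_neg ENNReal.coe_ne_top, ENNReal.toNNReal_coe]
  refine integral_congr_ae ?_
  filter_upwards [bitEstimate_ae γ] with ω h
  rw [h]

/-- Flipping the signs of both the bit and the noise preserves the error, as `llrMean` is odd and
the noise symmetric. -/
theorem integral_bit_error (γ : ℝ≥0) (b : Bool) :
    ∫ n, (bpsk b - llrMean (2 * √(γ : ℝ) * (√(γ : ℝ) * bpsk b + n))) ^ 2 ∂gaussianReal 0 1 =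
      ∫ n, (1 - llrMean (2 * √(γ : ℝ) * (√(γ : ℝ) + n))) ^ 2 ∂gaussianReal 0 1 := by
  cases b
  · have hneg : (gaussianReal 0 1).map (fun x => -x) = gaussianReal 0 1 := by
      rw [gaussianReal_map_neg, neg_zero]
    conv_rhs => rw [← hneg]
    have hc := continuous_llrMean
    rw [integral_map (by fun_prop) (by fun_prop)]
    congr 1
    ext n
    have : 2 * √(γ : ℝ) * (√(γ : ℝ) * bpsk false + n) = -(2 * √(γ : ℝ) * (√(γ : ℝ) + -n)) := by
      simp [bpsk]; ring
    rw [this, llrMean_neg]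
    simp only [bpsk]
    simp
    ring
  · simp [bpsk]

theorem integrable_bit_error (γ : ℝ≥0) (b : Bool) :
    Integrable (fun n => (bpsk b - llrMean (2 * √(γ : ℝ) * (√(γ : ℝ) * bpsk b + n))) ^ 2)
      (gaussianReal 0 1) := by
  have hc := continuous_llrMean
  exact integrable_of_bdd_measurable (by fun_prop) fun n => sq_sub_bdd (abs_llrMean_le _)

theorem integral_bit_error_eq_phi (γ : ℝ≥0) (b : Bool) :
    ∫ n, (bpsk b - llrMean (2 * √(γ : ℝ) * (√(γ : ℝ) * bpsk b + n))) ^ 2 ∂gaussianReal 0 1 =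
      phi γ := by
  rw [phi_coe, integral_bitLaw (fun b => integrable_bit_error γ b)]
  simp only [bitOutput, integral_bit_error]
  ring

theorem post_bit (a : ℝ) (y : Unit → ℝ) :
    post Finset.univ a (fun b _ => bpsk b) bpsk y = llrMean (2 * a * y ()) := by
  rw [post, mul_assoc, llrMean_two_mul]
  simp only [lik, Fintype.sum_bool, Finset.univ_unique, Finset.sum_singleton, bpsk, if_true,
    Bool.false_eq_true, if_false, mul_one, one_mul, Real.exp_sub, mul_neg, neg_mul, neg_sq,
    PUnit.default_eq_unit]
  have := Real.exp_pos (a ^ 2 / 2)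
  rw [← sub_eq_add_neg, ← sub_div, ← add_div, div_div_div_cancel_right₀ this.ne']

/-- A bit is the case of two signals in dimension one, which brings the general theory to bear on
`phi`. -/
theorem phi_eq_mse (γ : ℝ≥0) : phi γ =
    mse Finset.univ √(γ : ℝ) (fun b (_ : Unit) => bpsk b) bpsk
      (post Finset.univ √(γ : ℝ) (fun b _ => bpsk b) bpsk) := by
  simp only [mse, post_bit]
  have h : ∀ b, ∫ n : Unit → ℝ, (bpsk b - llrMean (2 * √(γ : ℝ) * (√(γ : ℝ) * bpsk b + n ()))) ^ 2
      ∂stdNoise Unit = phi γ := fun b => by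
    rw [← integral_bit_error_eq_phi γ b]
    exact integral_comp_eval (μ := fun _ : Unit => gaussianReal 0 1) (i := ())
      (f := fun t => (bpsk b - llrMean (2 * √(γ : ℝ) * (√(γ : ℝ) * bpsk b + t))) ^ 2)
      (integrable_bit_error γ b).1
  simp only [h]
  simp

theorem integrable_inv_cosh (a : ℝ) :
    Integrable (fun t => (Real.cosh (a * t))⁻¹) (gaussianReal 0 1) := by
  refine integrable_of_bdd_measurable (by fun_prop) (B := 1) fun t => ?_
  rw [abs_of_pos (inv_pos.2 (Real.cosh_pos _))]
  exact inv_le_one_of_one_le₀ (Real.one_le_cosh _)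

/-- The posterior variance of the bit is `1 - tanh² = 1 / cosh²`, and the total likelihood is `2 exp
(-γ / 2) cosh (√γ y)`. Both factors of the product are visibly nonincreasing in `γ`, the first
strictly. -/
theorem phi_eq_exp_mul (γ : ℝ≥0) : phi γ =
    Real.exp (-γ / 2) * ∫ t, (Real.cosh (√(γ : ℝ) * t))⁻¹ ∂gaussianReal 0 1 := by
  rw [phi_eq_mse, mse_eq (continuous_post Finset.univ_nonempty).measurable
    (abs_post_le Finset.univ_nonempty)]
  have h : ∀ y : Unit → ℝ, ∑ b, lik √(γ : ℝ) (fun _ => bpsk b) y *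
      (bpsk b - post Finset.univ √(γ : ℝ) (fun b _ => bpsk b) bpsk y) ^ 2 =
      2 * (Real.exp (-γ / 2) * (Real.cosh (√(γ : ℝ) * y ()))⁻¹) := by
    intro y
    rw [post_bit, mul_assoc 2, llrMean_two_mul, Real.cosh_eq]
    simp only [lik, Fintype.sum_bool, Finset.univ_unique, Finset.sum_singleton, bpsk, if_true,
      Bool.false_eq_true, if_false, mul_one, Real.exp_sub, mul_neg, neg_mul, neg_sq,
      PUnit.default_eq_unit]
    have hs : √(γ : ℝ) ^ 2 = γ := Real.sq_sqrt γ.2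
    rw [hs]
    rw [neg_div, Real.exp_neg ((γ : ℝ) / 2), Real.exp_neg (_ * _)]
    have h1 := Real.exp_pos (√(γ : ℝ) * y ())
    have h2 := Real.exp_pos ((γ : ℝ) / 2)
    set u := Real.exp (√(γ : ℝ) * y ())
    set v := Real.exp ((γ : ℝ) / 2)
    field_simp
    ring
  simp only [h, integral_const_mul]
  rw [stdNoise, integral_comp_eval (μ := fun _ : Unit => gaussianReal 0 1) (i := ())
      (f := fun t => (Real.cosh (√(γ : ℝ) * t))⁻¹) (integrable_inv_cosh _).1]
  simp

theorem integral_inv_cosh_pos (a : ℝ) :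
    0 < ∫ t, (Real.cosh (a * t))⁻¹ ∂gaussianReal 0 1 := by
  rw [integral_pos_iff_support_of_nonneg (fun t => (inv_pos.2 (Real.cosh_pos _)).le)
    (integrable_inv_cosh a)]
  have : Function.support (fun t => (Real.cosh (a * t))⁻¹) = univ := by
    ext t; simpa using (Real.cosh_pos _).ne'
  rw [this]; simp

theorem phi_coe_pos (γ : ℝ≥0) : 0 < phi γ := by
  rw [phi_eq_exp_mul]
  exact mul_pos (Real.exp_pos _) (integral_inv_cosh_pos _)

theorem phi_top : phi ⊤ = 0 := by simp [phi]

theorem phi_coe_le (γ : ℝ≥0) : phi γ ≤ Real.exp (-γ / 2) := by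
  rw [phi_eq_exp_mul]
  refine mul_le_of_le_one_right (Real.exp_pos _).le ?_
  have := integral_mono (μ := gaussianReal 0 1) (integrable_inv_cosh √(γ : ℝ))
    (integrable_const (1 : ℝ)) fun t => inv_le_one_of_one_le₀ (Real.one_le_cosh _)
  simpa using this

theorem phi_strictAnti : StrictAnti phi := by
  intro s t hst
  lift s to ℝ≥0 using hst.ne_top
  induction t with
  | top => rw [phi_top]; exact phi_coe_pos s
  | coe t =>
    have hst' : (s : ℝ) < t := by exact_mod_cast hst
    rw [phi_eq_exp_mul, phi_eq_exp_mul]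
    refine mul_lt_mul (Real.exp_lt_exp.2 (by linarith)) ?_ (integral_inv_cosh_pos _)
      (Real.exp_pos _).le
    refine integral_mono (integrable_inv_cosh _) (integrable_inv_cosh _) fun y => ?_
    refine inv_anti₀ (Real.cosh_pos _) (Real.cosh_le_cosh.2 ?_)
    rw [abs_mul, abs_mul, abs_of_nonneg (Real.sqrt_nonneg _), abs_of_nonneg (Real.sqrt_nonneg _)]
    exact mul_le_mul_of_nonneg_right (Real.sqrt_le_sqrt hst'.le) (abs_nonneg _)

theorem phi_nonneg (γ : ℝ≥0∞) : 0 ≤ phi γ := by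
  induction γ with
  | top => exact phi_top.ge
  | coe γ => exact (phi_coe_pos γ).le

theorem measurable_phi : Measurable phi := phi_strictAnti.antitone.measurable

theorem integral_phi :
    IntegrableOn (fun γ : ℝ => phi (ENNReal.ofReal γ)) (Ioi 0) ∧
      ∫ γ in Ioi (0 : ℝ), phi (ENNReal.ofReal γ) = Real.log 4 := by
  have hinj : Set.InjOn (fun b (_ : Unit) => bpsk b) (Finset.univ : Finset Bool) := by
    intro b _ b' _ h
    have h := congrFun h ()
    revert h
    cases b <;> cases b' <;> norm_num [bpsk]
  have h := integral_sum_mse_post (C := (Finset.univ : Finset Bool)) Finset.univ_nonempty hinj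
  have e : ∀ γ ∈ Ioi (0 : ℝ), ∑ j : Unit, mse Finset.univ √γ (fun b (_ : Unit) => bpsk b)
      (fun b => bpsk b) (post Finset.univ √γ (fun b _ => bpsk b) fun b => bpsk b) =
      phi (ENNReal.ofReal γ) := by
    intro γ hγ
    rw [ENNReal.ofReal, phi_eq_mse, Real.coe_toNNReal γ (le_of_lt hγ)]
    simp
  refine ⟨h.1.congr_fun e measurableSet_Ioi, ?_⟩
  rw [← setIntegral_congr_fun measurableSet_Ioi e, h.2]
  rw [show (4 : ℝ) = 2 ^ 2 by norm_num, Real.log_pow]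
  simp

end MSEChart

namespace MSEChart

/-! ### Test functions of a bit and a log likelihood ratio -/

/-- The mean of an antipodal bit whose log likelihood ratio is `l + r`. -/
noncomputable def llrMeanShift (r : ℝ) (l : EReal) : ℝ :=
  1 - 2 * (1 + EReal.exp l * ENNReal.ofReal (Real.exp r))⁻¹.toReal

theorem inv_one_add_le (u : ℝ≥0∞) : (1 + u)⁻¹ ≤ 1 := ENNReal.inv_le_one.2 le_self_add

/-- Continuity up to `±∞` is what admits this function into the weak convergence hypothesis. -/
theorem continuous_llrMeanShift (r : ℝ) : Continuous (llrMeanShift r) := by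
  unfold llrMeanShift
  refine continuous_const.sub (continuous_const.mul ?_)
  refine ENNReal.continuousOn_toReal.comp_continuous (continuous_inv.comp
    (continuous_const.add ((ENNReal.continuous_mul_const ENNReal.ofReal_ne_top).comp
      ENNReal.continuous_exp))) fun l => ?_
  exact ((inv_one_add_le _).trans_lt ENNReal.one_lt_top).ne

theorem measurable_llrMeanShift (l : EReal) : Measurable (fun r => llrMeanShift r l) := by
  unfold llrMeanShift
  fun_prop

theorem abs_llrMeanShift_le (r : ℝ) (l : EReal) : |llrMeanShift r l| ≤ 1 := by
  have h1 : (1 + EReal.exp l * ENNReal.ofReal (Real.exp r))⁻¹.toReal ≤ 1 := by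
    have := ENNReal.toReal_mono ENNReal.one_ne_top
      (inv_one_add_le (EReal.exp l * ENNReal.ofReal (Real.exp r)))
    simpa using this
  have h0 : 0 ≤ (1 + EReal.exp l * ENNReal.ofReal (Real.exp r))⁻¹.toReal := ENNReal.toReal_nonneg
  rw [abs_le, llrMeanShift]
  constructor <;> linarith

theorem llrMeanShift_coe (r t : ℝ) : llrMeanShift r t = llrMean (t + r) := by
  rw [llrMeanShift, llrMean, EReal.exp_coe, ← ENNReal.ofReal_mul (Real.exp_pos _).le,
    ← Real.exp_add, ← ENNReal.ofReal_one, ← ENNReal.ofReal_add zero_le_one (Real.exp_pos _).le,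
    ENNReal.toReal_inv, ENNReal.toReal_ofReal (by positivity), div_eq_mul_inv]

theorem llrMeanShift_top (r : ℝ) : llrMeanShift r ⊤ = 1 := by
  have : ENNReal.ofReal (Real.exp r) ≠ 0 := by simpa using Real.exp_pos r
  simp [llrMeanShift, ENNReal.top_mul this]

theorem llrMeanShift_bot (r : ℝ) : llrMeanShift r ⊥ = -1 := by
  simp [llrMeanShift]; norm_num

theorem llrMeanShift_log_sub_log {p q : ℝ} (hp : 0 ≤ p) (hq : 0 ≤ q) (hpq : p + q = 1) (r : ℝ) :
    llrMeanShift r (ENNReal.log (ENNReal.ofReal p) - ENNReal.log (ENNReal.ofReal q)) =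
      (p * Real.exp r - q) / (p * Real.exp r + q) := by
  rw [llrMeanShift, sub_eq_add_neg (ENNReal.log _), EReal.exp_add, EReal.exp_neg, ENNReal.exp_log, ENNReal.exp_log]
  have hr := Real.exp_pos r
  -- For `q = 0` the bit is certain and the log likelihood ratio is `⊤`.
  rcases hq.eq_or_lt with rfl | hq'
  · have hp1 : p = 1 := by linarith
    have : ENNReal.ofReal (Real.exp r) ≠ 0 := by simpa using hr
    simp [hp1, ENNReal.top_mul this, hr.ne']
  · rw [← ENNReal.ofReal_inv_of_pos hq', ← ENNReal.ofReal_mul hp, ← ENNReal.ofReal_mul (by positivity),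
      ← ENNReal.ofReal_one, ← ENNReal.ofReal_add zero_le_one (by positivity), ENNReal.toReal_inv,
      ENNReal.toReal_ofReal (by positivity)]
    have : 0 < p * Real.exp r + q := by positivity
    field_simp
    ring

theorem sq_sub_le_four {u v : ℝ} (hu : |u| ≤ 1) (hv : |v| ≤ 1) : |(u - v) ^ 2| ≤ 4 := by
  rw [abs_of_nonneg (sq_nonneg _)]
  have := abs_le.1 hu
  have := abs_le.1 hv
  nlinarith

/-- Squared error of the estimate of a bit from its log likelihood ratio. -/
noncomputable def llrError : (Bool × EReal) →ᵇ ℝ :=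
  BoundedContinuousFunction.ofNormedAddCommGroup
    (fun z => (bpsk z.1 - llrMeanShift 0 z.2) ^ 2)
    (((continuous_of_discreteTopology (f := bpsk)).comp continuous_fst |>.sub
      ((continuous_llrMeanShift 0).comp continuous_snd)).pow 2) 4
    (fun _ => sq_sub_le_four (abs_bpsk _).le (abs_llrMeanShift_le _ _))

theorem measurable_shifted_error (γ : ℝ≥0) (b : Bool) (l : EReal) : Measurable fun r =>
    (bpsk b - llrMeanShift (2 * √(γ : ℝ) * (√(γ : ℝ) * bpsk b + r)) l) ^ 2 := by
  have h : Measurable fun r => llrMeanShift (2 * √(γ : ℝ) * (√(γ : ℝ) * bpsk b + r)) l :=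
    (measurable_llrMeanShift l).comp (by fun_prop)
  fun_prop

theorem continuous_integral_shifted_error (γ : ℝ≥0) (b : Bool) : Continuous fun l : EReal =>
    ∫ r, (bpsk b - llrMeanShift (2 * √(γ : ℝ) * (√(γ : ℝ) * bpsk b + r)) l) ^ 2
      ∂gaussianReal 0 1 := by
  refine continuous_of_dominated (bound := fun _ => 4)
    (fun l => (measurable_shifted_error γ b l).aestronglyMeasurable)
    (fun l => ae_of_all _ fun r => sq_sub_le_four (abs_bpsk _).le (abs_llrMeanShift_le _ _))
    (integrable_const _) (ae_of_all _ fun r => ?_)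
  exact (continuous_const.sub (continuous_llrMeanShift _)).pow 2

/-- Mean squared error of the estimate of a bit from its log likelihood ratio and an independent
observation of it over a Gaussian channel. -/
noncomputable def llrErrorWith (γ : ℝ≥0) : (Bool × EReal) →ᵇ ℝ :=
  BoundedContinuousFunction.ofNormedAddCommGroup
    (fun z => ∫ r, (bpsk z.1 - llrMeanShift (2 * √(γ : ℝ) * (√(γ : ℝ) * bpsk z.1 + r)) z.2) ^ 2
      ∂gaussianReal 0 1)
    (continuous_prod_of_discrete_left.2 fun b => continuous_integral_shifted_error γ b) 4
    (fun z => by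
      have := norm_integral_le_of_norm_le_const (μ := gaussianReal 0 1) (C := 4)
        (f := fun r => (bpsk z.1 -
          llrMeanShift (2 * √(γ : ℝ) * (√(γ : ℝ) * bpsk z.1 + r)) z.2) ^ 2)
        (ae_of_all _ fun r => sq_sub_le_four (abs_bpsk _).le (abs_llrMeanShift_le _ _))
      simpa using this)

theorem integral_llrError_gaussLLR (γ : ℝ≥0∞) :
    ∫ ω, llrError (ω.1, gaussLLR γ ω) ∂bitLaw = phi γ := by
  induction γ with
  | top =>
    rw [phi_top]
    refine integral_eq_zero_of_ae (ae_of_all _ fun ω => ?_)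
    change (bpsk ω.1 - llrMeanShift 0 (gaussLLR ⊤ ω)) ^ 2 = 0
    cases h : ω.1 <;> simp [gaussLLR, h, llrMeanShift_top, llrMeanShift_bot, bpsk]
  | coe γ =>
    rw [phi_coe]
    congr 1
    ext ω
    change (bpsk ω.1 - llrMeanShift 0 (gaussLLR γ ω)) ^ 2 = _
    rw [gaussLLR, if_neg ENNReal.coe_ne_top, ENNReal.toNNReal_coe, llrMeanShift_coe, add_zero]

/-- Log likelihood ratios of independent observations add. With `t² = s` and `g² = γ`, the sum has
signal part `2 (t² + g²)` and noise `2 (t n + g r)`, exactly as over one channel of ratio `γ + s`.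
-/
theorem integral_llrErrorWith_gaussLLR (γ : ℝ≥0) (s : ℝ≥0∞) :
    ∫ ω, llrErrorWith γ (ω.1, gaussLLR s ω) ∂bitLaw = phi (γ + s) := by
  induction s with
  | top =>
    rw [add_top, phi_top]
    refine integral_eq_zero_of_ae (ae_of_all _ fun ω => ?_)
    refine integral_eq_zero_of_ae (ae_of_all _ fun r => ?_)
    change (bpsk ω.1 - llrMeanShift _ (gaussLLR ⊤ ω)) ^ 2 = 0
    cases h : ω.1 <;> simp [gaussLLR, h, llrMeanShift_top, llrMeanShift_bot, bpsk]
  | coe s =>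
    set g := √(γ : ℝ)
    set t := √(s : ℝ)
    have hg : g ^ 2 = γ := Real.sq_sqrt γ.2
    have ht : t ^ 2 = s := Real.sq_sqrt s.2
    have hc := continuous_llrMean
    have e : ∀ ω : Bool × ℝ, llrErrorWith γ (ω.1, gaussLLR s ω) = ∫ r, (bpsk ω.1 -
        llrMean (2 * t * (t * bpsk ω.1 + ω.2) + 2 * g * (g * bpsk ω.1 + r))) ^ 2
          ∂gaussianReal 0 1 := by
      intro ω
      change ∫ r, (bpsk ω.1 - llrMeanShift (2 * g * (g * bpsk ω.1 + r)) (gaussLLR s ω)) ^ 2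
        ∂gaussianReal 0 1 = _
      simp only [gaussLLR, if_neg ENNReal.coe_ne_top, ENNReal.toNNReal_coe, llrMeanShift_coe,
        bitOutput, t]
    simp only [e]
    set w := √((γ + s : ℝ≥0) : ℝ)
    have hw : w ^ 2 = γ + s := by
      have := Real.sq_sqrt (γ + s : ℝ≥0).2
      simpa [w] using this
    -- The unit vector in the direction of `(t, g)`; any unit vector will do when both vanish.
    obtain ⟨p, q, hpq, hpw, hqw⟩ : ∃ p q : ℝ, p ^ 2 + q ^ 2 = 1 ∧ w * p = t ∧ w * q = g := by
      rcases eq_or_ne w 0 with h0 | h0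
      · refine ⟨1, 0, by norm_num, ?_, ?_⟩
        · have h1 : t ^ 2 = 0 := by nlinarith [sq_nonneg t, sq_nonneg g, h0]
          rw [h0, zero_mul, pow_eq_zero_iff two_ne_zero |>.1 h1]
        · have h1 : g ^ 2 = 0 := by nlinarith [sq_nonneg t, sq_nonneg g, h0]
          rw [mul_zero, pow_eq_zero_iff two_ne_zero |>.1 h1]
      · refine ⟨t / w, g / w, ?_, mul_div_cancel₀ _ h0, mul_div_cancel₀ _ h0⟩
        rw [div_pow, div_pow, ← add_div, ht, hg, hw, add_comm, div_self]
        rw [← hw]; positivity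
    have hrot : ∀ b, ∫ n, ∫ r, (bpsk b - llrMean (2 * t * (t * bpsk b + n)
        + 2 * g * (g * bpsk b + r))) ^ 2 ∂gaussianReal 0 1 ∂gaussianReal 0 1 = phi ↑(γ + s) := by
      intro b
      rw [← integral_bit_error_eq_phi (γ + s) b]
      conv_rhs => rw [← gaussianReal_prod_map_rotation hpq]
      rw [integral_map (by fun_prop) (by fun_prop), integral_prod]
      · congr 1; ext n; congr 1; ext r
        congr 3
        change _ = 2 * w * (w * bpsk b + (p * n + q * r))
        rw [← hpw, ← hqw]
        linear_combination (2 * w ^ 2 * bpsk b) * hpq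
      · exact integrable_of_bdd_measurable (by fun_prop) fun z =>
          sq_sub_le_four (abs_bpsk _).le (abs_llrMean_le _)
    rw [integral_bitLaw]
    · simp only [hrot, ENNReal.coe_add]
      ring
    · intro b
      have hcont : Continuous fun z : ℝ × ℝ => (bpsk b - llrMean (2 * t * (t * bpsk b + z.1)
        + 2 * g * (g * bpsk b + z.2))) ^ 2 := by fun_prop
      refine integrable_of_bdd_measurable (B := 4)
        (hcont.measurable.stronglyMeasurable.integral_prod_right'
          (ν := gaussianReal 0 1)).measurable fun n => ?_
      have := norm_integral_le_of_norm_le_const (μ := gaussianReal 0 1) (C := 4)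
        (f := fun r => (bpsk b - llrMean (2 * t * (t * bpsk b + n)
          + 2 * g * (g * bpsk b + r))) ^ 2)
        (ae_of_all _ fun r => sq_sub_le_four (abs_bpsk _).le (abs_llrMean_le _))
      simpa using this

/-! ### Codes -/

variable {n : ℕ}

/-- The transmitted antipodal symbols of a codeword. -/
def symbols (c : Fin n → Bool) (j : Fin n) : ℝ := bpsk (c j)

/-- The transmitted antipodal symbols of a codeword, but for the `k`-th. -/
def otherSymbols (k : Fin n) (c : Fin n → Bool) (j : {j : Fin n // j ≠ k}) : ℝ := bpsk (c j)

/-- Least mean squared error of the `k`-th symbol of a codeword given all the observations. -/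
noncomputable def symbolError (C : Finset (Fin n → Bool)) (γ : ℝ) (k : Fin n) : ℝ :=
  mse C √γ symbols (fun c => symbols c k) (post C √γ symbols fun c => symbols c k)

/-- Least mean squared error of the `k`-th symbol of a codeword given the other observations. -/
noncomputable def extrinsicError (C : Finset (Fin n → Bool)) (γ : ℝ) (k : Fin n) : ℝ :=
  mse C √γ (otherSymbols k) (fun c => symbols c k) (post C √γ (otherSymbols k) fun c => symbols c k)

/-- Posterior probability of the value `b` of the `k`-th bit given the other observations. -/
noncomputable def bitPost (C : Finset (Fin n → Bool)) (γ : ℝ≥0) (k : Fin n) (b : Bool) :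
    ({j : Fin n // j ≠ k} → ℝ) → ℝ :=
  post C √(γ : ℝ) (otherSymbols k) (fun c => if c k = b then 1 else 0)

variable {C : Finset (Fin n → Bool)}

theorem abs_symbols (c : Fin n → Bool) (k : Fin n) : |symbols c k| = 1 := abs_bpsk _

theorem bitPost_nonneg (hC : C.Nonempty) (γ : ℝ≥0) (k : Fin n) (b : Bool) (y) :
    0 ≤ bitPost C γ k b y := by
  refine div_nonneg (Finset.sum_nonneg fun c _ => mul_nonneg ?_ (lik_pos _ _ _).le)
    (sum_lik_pos hC _ _ _).le
  change (0 : ℝ) ≤ if c k = b then 1 else 0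
  split_ifs <;> norm_num

theorem bitPost_add (hC : C.Nonempty) (γ : ℝ≥0) (k : Fin n) (y) :
    bitPost C γ k true y + bitPost C γ k false y = 1 := by
  rw [bitPost, bitPost, ← post_add]
  have : (fun c : Fin n → Bool => (if c k = true then (1 : ℝ) else 0) + if c k = false then 1 else 0)
      = fun _ => 1 := by
    ext c; cases c k <;> simp
  rw [this, post_const hC]

theorem bitPost_sub (γ : ℝ≥0) (k : Fin n) (y) :
    bitPost C γ k true y - bitPost C γ k false y =
      post C √(γ : ℝ) (otherSymbols k) (fun c => symbols c k) y := by
  rw [bitPost, bitPost, sub_eq_add_neg, ← neg_one_mul, ← post_const_mul, ← post_add]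
  congr 1
  ext c
  cases h : c k <;> simp [symbols, bpsk, h]

theorem lik_symbols (a : ℝ) (k : Fin n) (c : Fin n → Bool) (y : Fin n → ℝ) :
    lik a (symbols c) y = lik a (otherSymbols k c) (fun j => y j) *
      Real.exp (a * symbols c k * y k - a ^ 2 / 2) := by
  rw [lik, lik, ← Real.exp_add, Fintype.sum_eq_add_sum_subtype_ne _ k, add_comm]
  congr 2
  rw [mul_pow, symbols, bpsk_sq, mul_one]

/-- Given the codeword, the `k`-th observation is independent of the others, so it enters Bayes'
rule only through its log likelihood ratio `2 √γ y k`, added to the extrinsic one. -/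
theorem llrMeanShift_bitPost (hC : C.Nonempty) (γ : ℝ≥0) (k : Fin n) (y : Fin n → ℝ) :
    llrMeanShift (2 * √(γ : ℝ) * y k)
      (ENNReal.log (ENNReal.ofReal (bitPost C γ k true fun j => y j)) -
        ENNReal.log (ENNReal.ofReal (bitPost C γ k false fun j => y j))) =
      post C √(γ : ℝ) symbols (fun c => symbols c k) y := by
  rw [llrMeanShift_log_sub_log (bitPost_nonneg hC _ _ _ _) (bitPost_nonneg hC _ _ _ _)
    (bitPost_add hC _ _ _)]
  set a := √(γ : ℝ)
  set z : {j : Fin n // j ≠ k} → ℝ := fun j => y j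
  set S := ∑ c ∈ C, lik a (otherSymbols k c) z
  have hS : 0 < S := sum_lik_pos hC _ _ _
  have hp := post_mul_sum (a := a) (x := otherSymbols k)
    (f := fun c => if c k = true then (1 : ℝ) else 0) hC z
  have hq := post_mul_sum (a := a) (x := otherSymbols k)
    (f := fun c => if c k = false then (1 : ℝ) else 0) hC z
  change bitPost C γ k true z * S = _ at hp
  change bitPost C γ k false z * S = _ at hq
  set p := bitPost C γ k true z
  set q := bitPost C γ k false z
  set E := Real.exp (a * y k)
  have hE : 0 < E := Real.exp_pos _
  set K := Real.exp (a ^ 2 / 2)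
  have hK : 0 < K := Real.exp_pos _
  have h2 : Real.exp (2 * a * y k) = E * E := by
    rw [← Real.exp_add]; congr 1; ring
  have hnum : ∑ c ∈ C, symbols c k * lik a (symbols c) y = (p * S * E - q * S * E⁻¹) / K := by
    rw [hp, hq, Finset.sum_mul, Finset.sum_mul, ← Finset.sum_sub_distrib, Finset.sum_div]
    refine Finset.sum_congr rfl fun c _ => ?_
    rw [lik_symbols a k, Real.exp_sub]
    cases h : c k
    · simp [symbols, bpsk, h, Real.exp_neg, z, E, K]; ring
    · simp [symbols, bpsk, h, z, E, K]; ring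
  have hden : ∑ c ∈ C, lik a (symbols c) y = (p * S * E + q * S * E⁻¹) / K := by
    rw [hp, hq, Finset.sum_mul, Finset.sum_mul, ← Finset.sum_add_distrib, Finset.sum_div]
    refine Finset.sum_congr rfl fun c _ => ?_
    rw [lik_symbols a k, Real.exp_sub]
    cases h : c k
    · simp [symbols, bpsk, h, Real.exp_neg, z, E, K]; ring
    · simp [symbols, bpsk, h, z, E, K]; ring
  rw [post, hnum, hden, h2]
  have hpq : p + q = 1 := bitPost_add hC _ _ _
  have hp0 : 0 ≤ p := bitPost_nonneg hC _ _ _ _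
  have hq0 : 0 ≤ q := bitPost_nonneg hC _ _ _ _
  -- One of `p`, `q` may vanish when the other symbols determine the bit, but not both.
  have hpos : 0 < p * (E * E) + q := by
    rcases hp0.eq_or_lt with h | h
    · have : q = 1 := by linarith
      rw [← h, this]; norm_num
    · positivity
  rw [div_div_div_cancel_right₀ hK.ne']
  have e1 : p * S * E - q * S * E⁻¹ = (p * (E * E) - q) * (S * E⁻¹) := by field_simp
  have e2 : p * S * E + q * S * E⁻¹ = (p * (E * E) + q) * (S * E⁻¹) := by field_simp
  rw [e1, e2, mul_div_mul_right _ _ (by positivity)]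

theorem measurable_othersOutput (γ : ℝ≥0) (k : Fin n) : Measurable (othersOutput γ k) := by
  unfold othersOutput
  have : Measurable bpsk := measurable_of_countable _
  fun_prop

theorem extProb_ae (hC : C.Nonempty) (γ : ℝ≥0) (k : Fin n) (b : Bool) :
    extProb C γ k b =ᵐ[codeLaw C] fun ω => bitPost C γ k b (othersOutput γ k ω) := by
  have h := condExp_uniformOn_prod (ν := stdNoise (Fin n)) (ν' := stdNoise {j : Fin n // j ≠ k})
    hC (measurable_othersOutput γ k) (l := fun c => lik √(γ : ℝ) (otherSymbols k c))
    (fun c => (continuous_lik _ _).measurable) (fun c y => lik_pos _ _ _)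
    (fun c => by
      rw [← stdNoise_map_shift, ← (measurePreserving_restrict_ne k).map_eq,
        Measure.map_map (measurable_shift _ _) (measurePreserving_restrict_ne k).measurable]
      rfl) (fun c => if c k = b then 1 else 0)
  have e : Set.indicator {ω : (Fin n → Bool) × (Fin n → ℝ) | ω.1 k = b} (fun _ => (1 : ℝ)) =
      fun ω => if ω.1 k = b then 1 else 0 := by
    ext ω; simp [Set.indicator]
  rw [extProb, e]
  exact h

theorem extLLR_ae (hC : C.Nonempty) (γ : ℝ≥0) (k : Fin n) :
    extLLR C γ k =ᵐ[codeLaw C] fun ω =>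
      ENNReal.log (ENNReal.ofReal (bitPost C γ k true (othersOutput γ k ω))) -
        ENNReal.log (ENNReal.ofReal (bitPost C γ k false (othersOutput γ k ω))) := by
  filter_upwards [extProb_ae hC γ k true, extProb_ae hC γ k false] with ω h1 h2
  rw [extLLR, h1, h2]

theorem abs_post_symbols_le {ι : Type*} [Fintype ι] (hC : C.Nonempty) (a : ℝ)
    (x : (Fin n → Bool) → ι → ℝ) (k : Fin n) (y : ι → ℝ) :
    |post C a x (fun c => symbols c k) y| ≤ 1 :=
  abs_post_le_of_le hC (fun c _ => (abs_symbols c k).le) y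

theorem extMean_llrError (hC : C.Nonempty) (γ : ℝ≥0) :
    extMean C γ llrError = (∑ k, extrinsicError C γ k) / n := by
  rw [extMean]
  congr 1
  refine Finset.sum_congr rfl fun k _ => ?_
  set P := post C √(γ : ℝ) (otherSymbols k) fun c => symbols c k
  have hP : Continuous P := continuous_post hC
  have h1 : ∫ ω, llrError (ω.1 k, extLLR C γ k ω) ∂codeLaw C =
      ∫ ω, (symbols ω.1 k - P (othersOutput γ k ω)) ^ 2 ∂codeLaw C := by
    refine integral_congr_ae ?_
    filter_upwards [extLLR_ae hC γ k] with ω h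
    change (bpsk (ω.1 k) - llrMeanShift 0 _) ^ 2 = _
    rw [h, llrMeanShift_log_sub_log (bitPost_nonneg hC _ _ _ _) (bitPost_nonneg hC _ _ _ _)
      (bitPost_add hC _ _ _), Real.exp_zero, mul_one, bitPost_add hC, div_one, bitPost_sub]
    rfl
  rw [h1]
  have hO : ∀ c, Measurable fun m => othersOutput γ k (c, m) := fun c =>
    (measurable_othersOutput γ k).comp measurable_prodMk_left
  have h2 := integral_uniformOn_prod (ν := stdNoise (Fin n)) (C := C)
    (F := fun ω => (symbols ω.1 k - P (othersOutput γ k ω)) ^ 2) fun c _ =>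
      integrable_of_bdd_measurable (by have := hP.measurable; have := hO c; fun_prop)
        fun m => sq_sub_le_four (abs_symbols c k).le (abs_post_symbols_le hC _ _ _ _)
  refine h2.trans ?_
  rw [extrinsicError, mse]
  congr 1
  refine Finset.sum_congr rfl fun c _ => ?_
  have hr := measurePreserving_restrict_ne k
  have hG : Continuous fun m : {j : Fin n // j ≠ k} → ℝ =>
      (symbols c k - P fun j => √(γ : ℝ) * otherSymbols k c j + m j) ^ 2 := by fun_prop
  have h3 := integral_map (μ := stdNoise (Fin n)) hr.measurable.aemeasurable
    hG.aestronglyMeasurable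
  rw [hr.map_eq] at h3
  exact h3.symm

/-- The extrinsic ratio ignores the `k`-th noise sample, so the fresh noise in `llrErrorWith` can be
taken for that sample. -/
theorem extMean_llrErrorWith (hC : C.Nonempty) (γ : ℝ≥0) :
    extMean C γ (llrErrorWith γ) = (∑ k, symbolError C γ k) / n := by
  rw [extMean]
  congr 1
  refine Finset.sum_congr rfl fun k _ => ?_
  set P := post C √(γ : ℝ) symbols fun c => symbols c k
  have hP : Continuous P := continuous_post hC
  have hPb : ∀ y, |P y| ≤ 1 := abs_post_symbols_le hC _ _ _
  set F : (Fin n → Bool) → (Fin n → ℝ) → ℝ := fun c m =>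
    (symbols c k - P fun j => √(γ : ℝ) * symbols c j + m j) ^ 2
  have hF : ∀ c, Continuous (F c) := fun c => by fun_prop
  have hFb : ∀ c m, |F c m| ≤ 4 := fun c m => sq_sub_le_four (abs_symbols c k).le (hPb _)
  have h1 : ∫ ω, llrErrorWith γ (ω.1 k, extLLR C γ k ω) ∂codeLaw C =
      ∫ ω, ∫ r, F ω.1 (Function.update ω.2 k r) ∂gaussianReal 0 1 ∂codeLaw C := by
    refine integral_congr_ae ?_
    filter_upwards [extLLR_ae hC γ k] with ω h
    change ∫ r, (bpsk (ω.1 k) - llrMeanShift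
      (2 * √(γ : ℝ) * (√(γ : ℝ) * bpsk (ω.1 k) + r)) _) ^ 2 ∂gaussianReal 0 1 = _
    congr 1
    ext r
    simp only [F]
    congr 2
    simp only [P]
    rw [h, ← llrMeanShift_bitPost hC]
    have e : othersOutput γ k ω = fun j : {j : Fin n // j ≠ k} =>
        √(γ : ℝ) * symbols ω.1 j + Function.update ω.2 k r j := by
      ext j
      rw [Function.update_of_ne j.2]
      rfl
    rw [e, Function.update_self]
    rfl
  rw [h1]
  have hup : ∀ c, Continuous fun z : (Fin n → ℝ) × ℝ => F c (Function.update z.1 k z.2) :=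
    fun c => (hF c).comp (continuous_fst.update k continuous_snd)
  have h2 := integral_uniformOn_prod (ν := stdNoise (Fin n)) (C := C)
    (F := fun ω => ∫ r, F ω.1 (Function.update ω.2 k r) ∂gaussianReal 0 1) fun c _ => by
      refine integrable_of_bdd_measurable (B := 4)
        ((hup c).measurable.stronglyMeasurable.integral_prod_right'
          (ν := gaussianReal 0 1)).measurable fun m => ?_
      have := norm_integral_le_of_norm_le_const (μ := gaussianReal 0 1) (C := 4)
        (f := fun r => F c (Function.update m k r)) (ae_of_all _ fun r => hFb _ _)
      simpa using this
  refine h2.trans ?_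
  rw [symbolError, mse]
  congr 1
  refine Finset.sum_congr rfl fun c _ => ?_
  exact (integral_eq_integral_update k
    (integrable_of_bdd_measurable (hF c).measurable (hFb c))).symm

theorem symbolError_nonneg (γ : ℝ) (k : Fin n) : 0 ≤ symbolError C γ k :=
  div_nonneg (Finset.sum_nonneg fun _ _ => integral_nonneg fun _ => sq_nonneg _) (Nat.cast_nonneg _)

/-- Estimating the symbol from its own observation alone is a competitor. The bound is uniform over
codes and provides the dominating function. -/
theorem symbolError_le_phi (hC : C.Nonempty) (γ : ℝ≥0) (k : Fin n) :
    symbolError C γ k ≤ phi γ := by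
  have hc := continuous_llrMean
  refine (mse_post_le hC (h := fun y => llrMean (2 * √(γ : ℝ) * y k)) (by fun_prop)
    fun y => abs_llrMean_le _).trans_eq ?_
  have h : ∀ c : Fin n → Bool, ∫ m : Fin n → ℝ, (symbols c k - llrMean (2 * √(γ : ℝ) *
      (√(γ : ℝ) * symbols c k + m k))) ^ 2 ∂stdNoise (Fin n) = phi γ := fun c => by
    rw [← integral_bit_error_eq_phi γ (c k)]
    exact integral_comp_eval (μ := fun _ : Fin n => gaussianReal 0 1) (i := k)
      (f := fun t => (bpsk (c k) - llrMean (2 * √(γ : ℝ) * (√(γ : ℝ) * bpsk (c k) + t))) ^ 2)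
      (integrable_bit_error γ (c k)).1
  rw [mse]
  simp only [h]
  have : (C.card : ℝ) ≠ 0 := by exact_mod_cast hC.card_pos.ne'
  rw [Finset.sum_const, nsmul_eq_mul]
  field_simp

theorem integral_sum_symbolError (hC : C.Nonempty) :
    IntegrableOn (fun γ : ℝ => ∑ k, symbolError C γ k) (Ioi 0) ∧
      ∫ γ in Ioi (0 : ℝ), ∑ k, symbolError C γ k = 2 * Real.log C.card := by
  refine integral_sum_mse_post hC fun c _ c' _ h => ?_
  ext j
  have h := congrFun h j
  revert h
  simp only [symbols]
  cases c j <;> cases c' j <;> norm_num [bpsk]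

theorem extrinsicError_antitone (hC : C.Nonempty) {s t : ℝ} (h : s ≤ t) (k : Fin n) :
    extrinsicError C t k ≤ extrinsicError C s k :=
  mse_post_antitone hC (Real.sqrt_nonneg _) (Real.sqrt_le_sqrt h)

end MSEChart

namespace MSEChart

/-! ### The area on the two sides of the transfer curve -/

section Curve

variable {D : Set ℝ≥0} {h : ℝ≥0 → ℝ≥0∞}

theorem ae_toNNReal_mem (hD : volume ((fun t : ℝ≥0 => (t : ℝ)) '' Dᶜ) = 0) :
    ∀ᵐ t : ℝ, t ∈ Ioi 0 → t.toNNReal ∈ D := by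
  rw [ae_iff]
  refine measure_mono_null (fun t ht => ?_) hD
  simp only [mem_ofPred_eq, Classical.not_imp] at ht
  exact ⟨t.toNNReal, ht.2, Real.coe_toNNReal t (le_of_lt ht.1)⟩

/-- An interval has positive measure, so it cannot avoid `D`. -/
theorem exists_mem_between (hD : volume ((fun t : ℝ≥0 => (t : ℝ)) '' Dᶜ) = 0) {a b : ℝ≥0}
    (hab : a < b) : ∃ t ∈ D, a < t ∧ t < b := by
  have hab' : (a : ℝ) < b := by exact_mod_cast hab
  have h1 : volume (Ioo (a : ℝ) b) ≠ 0 := by simpa using hab'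
  obtain ⟨t, ht, h2⟩ := ((frequently_ae_mem_iff.2 h1).and_eventually (ae_toNNReal_mem hD)).exists
  have ht0 : 0 < t := a.2.trans_lt ht.1
  refine ⟨t.toNNReal, h2 ht0, ?_, ?_⟩
  · rw [← NNReal.coe_lt_coe, Real.coe_toNNReal t ht0.le]; exact ht.1
  · rw [← NNReal.coe_lt_coe, Real.coe_toNNReal t ht0.le]; exact ht.2

theorem restrict_Ioi_eq_of_ae {X : Set ℝ} {r : ℝ≥0}
    (hX : ∀ᵐ t : ℝ, t ∈ Ioi 0 → (t < r → t ∈ X) ∧ ((r : ℝ) < t → t ∉ X)) :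
    volume.restrict (Ioi 0) X = r := by
  have hae : X =ᵐ[volume.restrict (Ioi 0)] Iio (r : ℝ) := by
    rw [eventuallyEq_set, ae_restrict_iff' measurableSet_Ioi]
    have hne : ∀ᵐ t : ℝ, t ≠ r := by simp [ae_iff]
    filter_upwards [hX, hne] with t ht hne h0
    constructor
    · intro hm
      by_contra hlt
      exact (ht h0).2 (lt_of_le_of_ne (not_lt.1 hlt) hne.symm) hm
    · exact (ht h0).1
  rw [measure_congr hae, Measure.restrict_apply measurableSet_Iio, Iio_inter_Ioi, Real.volume_Ioo,
    sub_zero, ENNReal.ofReal_coe_nnreal]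

theorem apOfExt_mono (D : Set ℝ≥0) (h : ℝ≥0 → ℝ≥0∞) : Monotone (apOfExt D h) := by
  intro s s' hs
  exact biInf_mono fun t ht => ⟨ht.1, hs.trans ht.2⟩

/-- An antidiagonal is cut by the curve into two segments, whose projections have the total length
of the projection of the antidiagonal. -/
theorem volume_curve_add (hD : volume ((fun t : ℝ≥0 => (t : ℝ)) '' Dᶜ) = 0) (hm : MonotoneOn h D)
    {U : Set ℝ≥0∞} {v : ℝ≥0} (h1 : ∀ u < (v : ℝ≥0∞), u ∈ U) (h2 : ∀ u, (v : ℝ≥0∞) < u → u ∉ U) :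
    volume.restrict (Ioi 0) {t : ℝ | ENNReal.ofReal t + h t.toNNReal ∈ U} +
      volume.restrict (Ioi 0)
        {s : ℝ | apOfExt D h (ENNReal.ofReal s) + ENNReal.ofReal s ∈ U} =
      volume.restrict (Ioi 0) {u : ℝ | ENNReal.ofReal u ∈ U} := by
  set T : Set ℝ≥0 := {t | t ∈ D ∧ t + h t < v}
  have hTb : ∀ t ∈ T, t ≤ v := fun t ht =>
    ENNReal.coe_le_coe.1 (le_self_add.trans ht.2.le)
  have hbdd : BddAbove T := ⟨v, hTb⟩
  set τ := sSup T
  have hτv : τ ≤ v := csSup_le' hTb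
  have below : ∀ t ∈ D, t < τ → (t : ℝ≥0∞) + h t < v := by
    intro t htD ht
    -- An empty `T` has supremum `0`, and no `t` lies below it.
    have hne : T.Nonempty := by
      by_contra hemp
      rw [not_nonempty_iff_eq_empty] at hemp
      simp [τ, hemp] at ht
    obtain ⟨t', ht', hlt⟩ := exists_lt_of_lt_csSup hne ht
    exact (add_le_add (ENNReal.coe_le_coe.2 hlt.le) (hm htD ht'.1 hlt.le)).trans_lt ht'.2
  have above' : ∀ t ∈ D, τ < t → (v : ℝ≥0∞) ≤ t + h t := by
    intro t htD ht
    by_contra hlt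
    exact absurd (le_csSup hbdd ⟨htD, not_le.1 hlt⟩) (not_le.2 ht)
  -- Strictness is needed because `U` may or may not contain `v`; an intermediate point of `D`
  -- supplies it.
  have above : ∀ t ∈ D, τ < t → (v : ℝ≥0∞) < t + h t := by
    intro t htD ht
    obtain ⟨t', ht'D, h3, h4⟩ := exists_mem_between hD ht
    rcases eq_or_ne (h t') ⊤ with htop | htop
    · have : h t = ⊤ := top_le_iff.1 (htop ▸ hm ht'D htD h4.le)
      rw [this, add_top]
      exact ENNReal.coe_lt_top
    · exact (above' t' ht'D h3).trans_lt (ENNReal.add_lt_add_of_lt_of_le htop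
        (ENNReal.coe_lt_coe.2 h4) (hm ht'D htD h4.le))
  have eT : volume.restrict (Ioi 0) {t : ℝ | ENNReal.ofReal t + h t.toNNReal ∈ U} = τ := by
    refine restrict_Ioi_eq_of_ae ?_
    filter_upwards [ae_toNNReal_mem hD] with t ht h0
    refine ⟨fun hlt => h1 _ (below _ (ht h0) ?_), fun hlt => h2 _ (above _ (ht h0) ?_)⟩
    · rwa [← NNReal.coe_lt_coe, Real.coe_toNNReal t (le_of_lt h0)]
    · rwa [← NNReal.coe_lt_coe, Real.coe_toNNReal t (le_of_lt h0)]
  have lower : ∀ s : ℝ≥0, s < v - τ → apOfExt D h s + s < v := by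
    intro s hs
    have hs' : τ < v - s := lt_tsub_comm.1 hs
    -- A point beyond the crossing but before `v - s` already has height at least `s`, hence bounds
    -- `apOfExt D h s`.
    obtain ⟨t, htD, h3, h4⟩ := exists_mem_between hD hs'
    have h5 : t + s < v := lt_tsub_iff_right.1 h4
    have h6 : (s : ℝ≥0∞) ≤ h t := by
      by_contra hlt
      have h7 : (t : ℝ≥0∞) + h t < v :=
        (add_le_add le_rfl (not_le.1 hlt).le).trans_lt (by exact_mod_cast h5)
      exact absurd h7 (not_lt.2 (above' t htD h3))
    have h8 : apOfExt D h s ≤ t := iInf₂_le t ⟨htD, h6⟩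
    exact (add_le_add h8 le_rfl).trans_lt (by exact_mod_cast h5)
  have upper' : ∀ s : ℝ≥0, v - τ < s → (v : ℝ≥0∞) ≤ apOfExt D h s + s := by
    intro s hs
    rw [← tsub_le_iff_right]
    refine le_iInf₂ fun t ht => ?_
    rw [tsub_le_iff_right]
    by_contra hlt
    rw [not_le] at hlt
    have h3 : v < s + τ := by
      have := tsub_lt_iff_right hτv |>.1 hs
      exact this
    have h4 : t + s < v := by exact_mod_cast hlt
    have h5 : t < τ := by
      have : s + t < s + τ := by rw [add_comm s t]; exact h4.trans h3
      exact lt_of_add_lt_add_left this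
    have h6 : v - s < τ := by
      have h7 : s ≤ v := le_of_add_le_right h4.le
      exact (tsub_lt_iff_left h7).2 h3
    -- Being above `t`, the point `t'` has height at least `s`; being above `v - s`, it lies on or
    -- past the antidiagonal, although it precedes `τ`.
    obtain ⟨t', ht'D, h8, h9⟩ := exists_mem_between hD (max_lt h5 h6)
    have h10 : (s : ℝ≥0∞) ≤ h t' := ht.2.trans (hm ht.1 ht'D ((le_max_left _ _).trans h8.le))
    have h11 : v ≤ t' + s := by
      rw [← tsub_le_iff_right]; exact (le_max_right _ _).trans h8.le
    have h12 : (v : ℝ≥0∞) ≤ t' + h t' :=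
      (ENNReal.coe_le_coe.2 h11).trans (by rw [ENNReal.coe_add]; exact add_le_add le_rfl h10)
    exact absurd (below t' ht'D h9) (not_lt.2 h12)
  have upper : ∀ s : ℝ≥0, v - τ < s → (v : ℝ≥0∞) < apOfExt D h s + s := by
    intro s hs
    obtain ⟨s', h3, h4⟩ := exists_between hs
    have h5 := apOfExt_mono D h (ENNReal.coe_le_coe.2 h4.le)
    rcases eq_or_ne (apOfExt D h s') ⊤ with htop | htop
    · rw [htop, top_le_iff] at h5
      rw [h5, top_add]
      exact ENNReal.coe_lt_top
    · exact (upper' s' h3).trans_lt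
        (ENNReal.add_lt_add_of_le_of_lt htop h5 (ENNReal.coe_lt_coe.2 h4))
  have eS : volume.restrict (Ioi 0)
      {s : ℝ | apOfExt D h (ENNReal.ofReal s) + ENNReal.ofReal s ∈ U} = (v - τ : ℝ≥0) := by
    refine restrict_Ioi_eq_of_ae (ae_of_all _ fun s h0 => ?_)
    refine ⟨fun hlt => h1 _ (lower s.toNNReal ?_), fun hlt => h2 _ (upper s.toNNReal ?_)⟩
    · rwa [← NNReal.coe_lt_coe, Real.coe_toNNReal s (le_of_lt h0)]
    · rwa [← NNReal.coe_lt_coe, Real.coe_toNNReal s (le_of_lt h0)]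
  have eU : volume.restrict (Ioi 0) {u : ℝ | ENNReal.ofReal u ∈ U} = v := by
    refine restrict_Ioi_eq_of_ae (ae_of_all _ fun u h0 => ?_)
    refine ⟨fun hlt => h1 _ (ENNReal.coe_lt_coe.2 ?_), fun hlt => h2 _ (ENNReal.coe_lt_coe.2 ?_)⟩
    · rwa [← NNReal.coe_lt_coe, Real.coe_toNNReal u (le_of_lt h0)]
    · rwa [← NNReal.coe_lt_coe, Real.coe_toNNReal u (le_of_lt h0)]
  rw [eT, eS, eU, ← ENNReal.coe_add, add_tsub_cancel_of_le hτv]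

/-- By the layer cake formula it is enough to compare superlevel sets of `phi`; these are initial
intervals with finite supremum `v`, as `phi` decreases to `0`. -/
theorem lintegral_curve_add (hD : volume ((fun t : ℝ≥0 => (t : ℝ)) '' Dᶜ) = 0)
    (hm : MonotoneOn h D)
    (hmeas : AEMeasurable (fun t : ℝ => phi (ENNReal.ofReal t + h t.toNNReal))
      (volume.restrict (Ioi 0))) :
    (∫⁻ t in Ioi (0 : ℝ), ENNReal.ofReal (phi (ENNReal.ofReal t + h t.toNNReal))) +
      ∫⁻ s in Ioi (0 : ℝ),
        ENNReal.ofReal (phi (apOfExt D h (ENNReal.ofReal s) + ENNReal.ofReal s)) =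
      ∫⁻ u in Ioi (0 : ℝ), ENNReal.ofReal (phi (ENNReal.ofReal u)) := by
  have hmS : Measurable fun s : ℝ => phi (apOfExt D h (ENNReal.ofReal s) + ENNReal.ofReal s) :=
    measurable_phi.comp ((((apOfExt_mono D h).measurable).comp ENNReal.measurable_ofReal).add
      ENNReal.measurable_ofReal)
  have hmU : Measurable fun u : ℝ => phi (ENNReal.ofReal u) :=
    measurable_phi.comp ENNReal.measurable_ofReal
  rw [lintegral_eq_lintegral_meas_lt _ (ae_of_all _ fun t => phi_nonneg _) hmeas,
    lintegral_eq_lintegral_meas_lt _ (ae_of_all _ fun t => phi_nonneg _) hmS.aemeasurable,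
    lintegral_eq_lintegral_meas_lt _ (ae_of_all _ fun t => phi_nonneg _) hmU.aemeasurable,
    ← lintegral_add_left]
  · refine setLIntegral_congr_fun measurableSet_Ioi fun y hy => ?_
    set U : Set ℝ≥0∞ := {u | y < phi u}
    have hlow : ∀ u ∈ U, ∀ w ≤ u, w ∈ U := fun u hu w hw =>
      lt_of_lt_of_le (show y < phi u from hu) (phi_strictAnti.antitone hw)
    obtain ⟨b, hb⟩ : ∃ b : ℝ≥0, (b : ℝ≥0∞) ∉ U := by
      have hlim : Tendsto (fun b : ℝ≥0 => Real.exp (-(b : ℝ) / 2)) atTop (𝓝 0) := by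
        refine Real.tendsto_exp_atBot.comp ?_
        have h3 : Tendsto (fun b : ℝ≥0 => (b : ℝ)) atTop atTop := NNReal.tendsto_coe_atTop.2 tendsto_id
        exact (tendsto_neg_atTop_atBot.comp h3).atBot_div_const two_pos
      obtain ⟨b, hb⟩ := (hlim.eventually (gt_mem_nhds hy)).exists
      exact ⟨b, fun hU => absurd (lt_trans hU ((phi_coe_le b).trans_lt hb)) (lt_irrefl _)⟩
    have hsup : sSup U ≤ b := sSup_le fun u hu => by
      by_contra hlt
      exact hb (hlow u hu b (not_le.1 hlt).le)
    have hv : ((sSup U).toNNReal : ℝ≥0∞) = sSup U :=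
      ENNReal.coe_toNNReal (hsup.trans_lt ENNReal.coe_lt_top).ne
    refine volume_curve_add hD hm (U := U) (v := (sSup U).toNNReal) (fun u hu => ?_) fun u hu => ?_
    · rw [hv] at hu
      obtain ⟨w, hw, huw⟩ := lt_sSup_iff.1 hu
      exact hlow w hw u huw.le
    · rw [hv] at hu
      exact fun hU => absurd (le_sSup hU) (not_le.2 hu)
  -- The measure of a superlevel set is antitone in the level, hence measurable; additivity of the
  -- integral requires this.
  · exact Antitone.measurable fun y y' hyy => measure_mono fun t ht => lt_of_le_of_lt hyy ht

end Curve

end MSEChart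

/-! ### The area property of the transfer curve -/

open MSEChart in
theorem lemma2 (len : ℕ → ℕ) (hlen : ∀ m, 0 < len m)
    (C : ∀ m, Finset (Fin (len m) → Bool)) (hC : ∀ m, (C m).Nonempty)
    (R : ℝ) (hR : Tendsto (fun m => MSEChart.rate (C m)) atTop (𝓝 R))
    (D : Set ℝ≥0) (hD : volume ((fun t : ℝ≥0 => (t : ℝ)) '' Dᶜ) = 0) (γext : ℝ≥0 → ℝ≥0∞)
    (hGauss : ∀ γap ∈ D, MSEChart.ExtrinsicIsGaussian C γap (γext γap)) :
    IntegrableOn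
        (fun s : ℝ => MSEChart.phi
          (MSEChart.apOfExt D γext (ENNReal.ofReal s) + ENNReal.ofReal s)) (Ioi 0) ∧
      ∫ s in Ioi (0 : ℝ), MSEChart.phi
          (MSEChart.apOfExt D γext (ENNReal.ofReal s) + ENNReal.ofReal s)
        = (1 - R) * Real.log 4 := by
  have hpos : ∀ m, (0 : ℝ) < len m := fun m => by exact_mod_cast hlen m
  -- `phi (γext t)` is a limit of errors that do not increase with `t`, and `phi` reverses order
  -- strictly.
  have hmono : MonotoneOn γext D := by
    intro s hs t ht hst
    have h1 := hGauss s hs llrError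
    have h2 := hGauss t ht llrError
    rw [integral_llrError_gaussLLR] at h1 h2
    refine phi_strictAnti.le_iff_ge.1 (le_of_tendsto_of_tendsto' h2 h1 fun m => ?_)
    rw [extMean_llrError (hC m), extMean_llrError (hC m)]
    exact div_le_div_of_nonneg_right (Finset.sum_le_sum fun k _ =>
      extrinsicError_antitone (hC m) (by exact_mod_cast hst) k) (hpos m).le
  set u : ℕ → ℝ → ℝ := fun m γ => (∑ k, symbolError (C m) γ k) / len m
  have hu := fun m => integral_sum_symbolError (hC m)
  have hlim : ∀ᵐ γ : ℝ ∂volume.restrict (Ioi 0), Tendsto (fun m => u m γ) atTop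
      (𝓝 (phi (ENNReal.ofReal γ + γext γ.toNNReal))) := by
    rw [ae_restrict_iff' measurableSet_Ioi]
    filter_upwards [ae_toNNReal_mem hD] with γ hγ h0
    have h1 := hGauss _ (hγ h0) (llrErrorWith γ.toNNReal)
    rw [integral_llrErrorWith_gaussLLR] at h1
    refine h1.congr fun m => ?_
    rw [extMean_llrErrorWith (hC m), Real.coe_toNNReal γ (le_of_lt h0)]
  have hbound : ∀ m, ∀ᵐ γ : ℝ ∂volume.restrict (Ioi 0), ‖u m γ‖ ≤ phi (ENNReal.ofReal γ) := by
    intro m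
    rw [ae_restrict_iff' measurableSet_Ioi]
    refine ae_of_all _ fun γ h0 => ?_
    rw [Real.norm_eq_abs, abs_of_nonneg (div_nonneg (Finset.sum_nonneg fun k _ =>
      symbolError_nonneg γ k) (hpos m).le), div_le_iff₀ (hpos m)]
    have h1 := Finset.sum_le_card_nsmul Finset.univ (fun k => symbolError (C m) γ k)
      (phi (ENNReal.ofReal γ)) fun k _ => by
        have := symbolError_le_phi (hC m) γ.toNNReal k
        rwa [Real.coe_toNNReal γ (le_of_lt h0)] at this
    simpa [mul_comm] using h1
  have humeas : ∀ m, AEStronglyMeasurable (u m) (volume.restrict (Ioi 0)) := fun m =>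
    ((hu m).1.div_const _).1
  have hmeas := aestronglyMeasurable_of_tendsto_ae atTop humeas hlim
  have hconv := tendsto_integral_of_dominated_convergence _ humeas integral_phi.1 hbound hlim
  -- Twice the entropy in nats per symbol: `2 log |C| / n` is the rate times `2 log 2`.
  have hval : ∀ m, ∫ γ in Ioi (0 : ℝ), u m γ = rate (C m) * Real.log 4 := by
    intro m
    rw [integral_div, (hu m).2, rate, Real.logb, show (4 : ℝ) = 2 ^ 2 by norm_num, Real.log_pow]
    have := Real.log_pos one_lt_two
    field_simp
    push_cast
    ring
  have hA : ∫ γ in Ioi (0 : ℝ), phi (ENNReal.ofReal γ + γext γ.toNNReal) = R * Real.log 4 := by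
    refine tendsto_nhds_unique hconv ?_
    simp only [hval]
    exact hR.mul_const _
  have hAint : IntegrableOn (fun γ : ℝ => phi (ENNReal.ofReal γ + γext γ.toNNReal)) (Ioi 0) := by
    refine integral_phi.1.mono' hmeas (ae_of_all _ fun γ => ?_)
    rw [Real.norm_eq_abs, abs_of_nonneg (phi_nonneg _)]
    exact phi_strictAnti.antitone le_self_add
  have hadd := lintegral_curve_add hD hmono hmeas.aemeasurable
  rw [← ofReal_integral_eq_lintegral_ofReal hAint (ae_of_all _ fun _ => phi_nonneg _), hA,
    ← ofReal_integral_eq_lintegral_ofReal integral_phi.1 (ae_of_all _ fun _ => phi_nonneg _),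
    integral_phi.2] at hadd
  have hmS : Measurable fun s : ℝ =>
      phi (apOfExt D γext (ENNReal.ofReal s) + ENNReal.ofReal s) :=
    measurable_phi.comp ((((apOfExt_mono D γext).measurable).comp ENNReal.measurable_ofReal).add
      ENNReal.measurable_ofReal)
  have hint : IntegrableOn (fun s : ℝ =>
      phi (apOfExt D γext (ENNReal.ofReal s) + ENNReal.ofReal s)) (Ioi 0) := by
    refine ⟨hmS.aestronglyMeasurable, ?_⟩
    rw [hasFiniteIntegral_iff_ofReal (ae_of_all _ fun _ => phi_nonneg _)]
    exact (le_add_self.trans_eq hadd).trans_lt ENNReal.ofReal_lt_top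
  refine ⟨hint, ?_⟩
  have hB0 : 0 ≤ ∫ s in Ioi (0 : ℝ), phi (apOfExt D γext (ENNReal.ofReal s) + ENNReal.ofReal s) :=
    integral_nonneg fun _ => phi_nonneg _
  -- `ENNReal.ofReal` truncates negative numbers, so signs are needed to return to a real identity.
  have hA0 : 0 ≤ R * Real.log 4 := hA ▸ integral_nonneg fun _ => phi_nonneg _
  rw [← ofReal_integral_eq_lintegral_ofReal hint (ae_of_all _ fun _ => phi_nonneg _),
    ← ENNReal.ofReal_add hA0 hB0, ENNReal.ofReal_eq_ofReal_iff (add_nonneg hA0 hB0)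
      (Real.log_nonneg (by norm_num))] at hadd
  linarith
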